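/- Let $\nu\ge 2$ and let $f:\mathbb R^\nu\to\mathbb R$ be a $C^\infty$ function of the variables $k=(k_1,\dots,k_\nu)$ with a critical point at $0$. Suppose that the kernel of the second differential of $f$ at $0$ is exactly the coordinate plane spanned by the $k_1$- and $k_2$-axes (so $0$ is a critical point of co-rank $2$). Put $$A=\frac1{3!}\frac{\partial^3 f(0)}{\partial k_1^3},\quad B=\frac1{2!}\frac{\partial^3 f(0)}{\partial k_1^2\partial k_2},\quad C=\frac1{2!}\frac{\partial^3 f(0)}{\partial k_1\partial k_2^2},\quad D=\frac1{3!}\frac{\partial^3 f(0)}{\partial k_2^3},$$ $$\Delta_3=4(B^3D+AC^3)+27A^2D^2-B^2C^2-18ABCD .$$ A change of variables at $0$ means a $C^\infty$ diffeomorphism between open neighbourhoods of the origin that fixes the origin. A germ at $0$ has a singularity of type $D_4^{\pm}$ if it is stably $R^+$-equivalent to the germ at $0$ of $x^2y\pm y^3$ on $\mathbb R^2$, that is, if after adding to each of the two germs a nondegenerate quadratic form in new variables (possibly in zero variables) the two germs agree near $0$ up to a change of variables and an additive constant. It has type $D_4$ if it has type $D_4^+$ or $D_4^-$. Then: 1.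 The germ of $f$ at $0$ has a singularity of type $D_4$ if and only if $\Delta_3\neq0$. 2. If $\Delta_3\ne0$, then there are a change of variables $k\mapsto\tilde k$ at $0$, a constant $d$, and a nondegenerate quadratic form $Q$ in $\nu-2$ variables such that, in a neighbourhood of $0$, $$f=d+\tilde k_1^2\tilde k_2+\Delta_3\,\tilde k_2^3+Q(\tilde k_3,\dots,\tilde k_\nu).$$ 3. The germ of $f$ at $0$ has type $D_4^+$ if and only if $\Delta_3>0$, and type $D_4^-$ if and only if $\Delta_3<0$. -/

import Mathlib

open scoped ContDiff

noncomputable section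

/-- A local change of variables at the origin that fixes the origin: a smooth diffeomorphism,
with smooth inverse, from an open neighbourhood of `0` onto an open neighbourhood of `0`. -/
def IsChangeOfVariables {E F : Type*} [NormedAddCommGroup E] [NormedSpace ℝ E]
    [NormedAddCommGroup F] [NormedSpace ℝ F] (φ : OpenPartialHomeomorph E F) : Prop :=
  0 ∈ φ.source ∧ φ 0 = 0 ∧ ContDiffOn ℝ ∞ φ φ.source ∧ ContDiffOn ℝ ∞ φ.symm φ.target

/-- `R⁺`-equivalence of germs at the origin: equality near `0` up to a change of variables
fixing `0` and an additive constant. -/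
def RPlusEquivalent {E F : Type*} [NormedAddCommGroup E] [NormedSpace ℝ E]
    [NormedAddCommGroup F] [NormedSpace ℝ F] (f : E → ℝ) (g : F → ℝ) : Prop :=
  ∃ (φ : OpenPartialHomeomorph E F) (d : ℝ),
    IsChangeOfVariables φ ∧ ∀ x ∈ φ.source, f x = d + g (φ x)

/-- Stable `R⁺`-equivalence of germs at the origin, possibly in different numbers of variables:
the germs become `R⁺`-equivalent after the addition of nondegenerate quadratic forms
in new variables. -/
def StablyRPlusEquivalent {E F : Type*} [NormedAddCommGroup E] [NormedSpace ℝ E]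
    [NormedAddCommGroup F] [NormedSpace ℝ F] (f : E → ℝ) (g : F → ℝ) : Prop :=
  ∃ (p q : ℕ) (Q₁ : QuadraticForm ℝ (Fin p → ℝ)) (Q₂ : QuadraticForm ℝ (Fin q → ℝ)),
    Q₁.polarBilin.Nondegenerate ∧ Q₂.polarBilin.Nondegenerate ∧
    RPlusEquivalent (fun x : E × (Fin p → ℝ) => f x.1 + Q₁ x.2)
      (fun y : F × (Fin q → ℝ) => g y.1 + Q₂ y.2)

/-- The germ of `f` at the origin has a singularity of type `D₄⁺` (normal form `x²y + y³`). -/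
def HasTypeD4Plus {ν : ℕ} (f : (Fin ν → ℝ) → ℝ) : Prop :=
  StablyRPlusEquivalent f (fun x : Fin 2 → ℝ => x 0 ^ 2 * x 1 + x 1 ^ 3)

/-- The germ of `f` at the origin has a singularity of type `D₄⁻` (normal form `x²y - y³`). -/
def HasTypeD4Minus {ν : ℕ} (f : (Fin ν → ℝ) → ℝ) : Prop :=
  StablyRPlusEquivalent f (fun x : Fin 2 → ℝ => x 0 ^ 2 * x 1 - x 1 ^ 3)

/-- The germ of `f` at the origin has a singularity of type `D₄`, i.e. `D₄⁺` or `D₄⁻`. -/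
def HasTypeD4 {ν : ℕ} (f : (Fin ν → ℝ) → ℝ) : Prop :=
  HasTypeD4Plus f ∨ HasTypeD4Minus f

/-- The `i`-th standard basis vector of `ℝ^ν`. -/
def stdVec {ν : ℕ} (i : Fin ν) : Fin ν → ℝ := Pi.single i 1

/-- The third partial derivative `∂³f(0) / ∂kᵢ ∂kⱼ ∂kₗ`. -/
def thirdPartial {ν : ℕ} (f : (Fin ν → ℝ) → ℝ) (i j l : Fin ν) : ℝ :=
  iteratedFDeriv ℝ 3 f 0 ![stdVec i, stdVec j, stdVec l]

/-- The kernel of the second differential of `f` at the origin. -/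
def secondDifferentialKer {ν : ℕ} (f : (Fin ν → ℝ) → ℝ) : Submodule ℝ (Fin ν → ℝ) :=
  LinearMap.ker (fderiv ℝ (fderiv ℝ f) 0).toLinearMap

/-- The discriminant `4(B³D + AC³) + 27A²D² - B²C² - 18ABCD` of the binary cubic form
`Ax³ + Bx²y + Cxy² + Dy³`. -/
def cubicDiscr (A B C D : ℝ) : ℝ :=
  4 * (B ^ 3 * D + A * C ^ 3) + 27 * A ^ 2 * D ^ 2 - B ^ 2 * C ^ 2 - 18 * A * B * C * D

/-- The discriminant `Δ₃` of the cubic part at the origin of `f(k₁, k₂, 0, …, 0)`; the variables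
are `k₁, …, k_{n+2}`, with indices starting from `0` in the code. -/
def discr3 {n : ℕ} (f : (Fin (n + 2) → ℝ) → ℝ) : ℝ :=
  cubicDiscr (1 / 6 * thirdPartial f 0 0 0) (1 / 2 * thirdPartial f 0 0 1)
    (1 / 2 * thirdPartial f 0 1 1) (1 / 6 * thirdPartial f 1 1 1)

end

/-!
The proof is elementary: it uses the inverse function theorem and Hadamard's lemma, but no flows
and no general determinacy theorem.

*Existence of the normal form.* The splitting lemma with parameters (`exists_splitting`) writes
`f (x, z) = f (x, ψ x) + ½ H (w, w)`, where `H` is the Hessian in the variables `z` transversal to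
the kernel, `ψ x` is the critical point of `f (x, ·)`, and `w` comes from a square root of a family
of operators close to the identity. There remains a function `g` of two variables whose Taylor
expansion begins with the cubic form `c` of `f` on the kernel. A real binary cubic has a real
linear factor, so it may be assumed that `c = y (α x² + β x y + γ y²)`; the discriminant is nonzero
exactly when `α ≠ 0` and `4 α γ - β² ≠ 0`. In the blow-up chart `y = x u` the simple root `u = 0` of
`c` extends to a smooth branch of the level set of `g` (`HasCubicLeadingTerm.exists_branch`). With
`η` an equation of that branch, `g = g 0 + η q (η, x)`, and `q` has a nondegenerate second
derivative in `x`. The same splitting lemma, now with `η` as parameter, gives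
`q = η² s (η) + α w²`, so that `g = g 0 + α η w² + η³ s (η)`; rescaling `w` and `η` by functions of
`η` gives `X² Y + e Y³` for every `e` of the sign of `Δ₃`
(`HasCubicLeadingTerm.exists_planar_normal_form`). The values `e = Δ₃`, `e = 1` and `e = -1` are the
ones needed.

*Necessity.* A change of variables between `f + Q₁` and `g + Q₂` maps the kernel of one Hessian to
the kernel of the other one, and the cubic form on the kernel is carried along
(`RPlusEquivalent.exists_kernel_map`); it is enough to compare the two sides along straight lines up
to order three. As the discriminant of a binary cubic is multiplied by the sixth power of the
determinant (`cubicDiscr_of_substitution`), its sign is an invariant, and it is `4 ε` for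
`x² y + ε y³`.

Locally defined smooth maps are replaced throughout by globally smooth ones with the same germ at
the origin, and identities of germs are stated with `∀ᶠ x in 𝓝 0`.
-/

/-! ### Smooth germs: Hadamard's lemma and the inverse function theorem -/

section Smooth

open Filter Topology Set MeasureTheory

variable {E F V : Type} [NormedAddCommGroup E] [NormedSpace ℝ E] [FiniteDimensional ℝ E]
  [NormedAddCommGroup F] [NormedSpace ℝ F] [FiniteDimensional ℝ F]
  [NormedAddCommGroup V] [NormedSpace ℝ V]

theorem hasFDerivAt_intervalIntegral_of_contDiff [CompleteSpace V] {k : E × ℝ → V}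
    (hk : ContDiff ℝ 1 k) (x : E) :
    HasFDerivAt (fun x => ∫ t in (0 : ℝ)..1, k (x, t))
      (∫ t in (0 : ℝ)..1, (fderiv ℝ k (x, t)).comp (ContinuousLinearMap.inl ℝ E ℝ)) x := by
  have hd : Continuous fun p => (fderiv ℝ k p).comp (ContinuousLinearMap.inl ℝ E ℝ) :=
    (hk.continuous_fderiv one_ne_zero).clm_comp continuous_const
  obtain ⟨C, hC⟩ := ((isCompact_closedBall x 1).prod (isCompact_Icc (a := (0 : ℝ)) (b := 1))
    ).exists_bound_of_continuousOn hd.continuousOn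
  have hc := hk.continuous
  refine intervalIntegral.hasFDerivAt_integral_of_dominated_of_fderiv_le
    (F' := fun x t => (fderiv ℝ k (x, t)).comp (ContinuousLinearMap.inl ℝ E ℝ))
    (bound := fun _ => C) (Metric.closedBall_mem_nhds x one_pos) ?_ ?_ ?_ ?_ ?_ ?_
  · exact Eventually.of_forall fun y =>
      (by fun_prop : Continuous fun t => k (y, t)).aestronglyMeasurable
  · exact (by fun_prop : Continuous fun t => k (x, t)).intervalIntegrable _ _
  · exact (hd.comp (by fun_prop : Continuous fun t : ℝ => (x, t))).aestronglyMeasurable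
  · refine Eventually.of_forall fun t ht y hy => hC (y, t) ⟨hy, ?_⟩
    rw [uIoc_of_le zero_le_one] at ht
    exact ⟨ht.1.le, ht.2⟩
  · exact intervalIntegrable_const
  · refine Eventually.of_forall fun t _ y _ => ?_
    exact ((hk.differentiable one_ne_zero) (y, t)).hasFDerivAt.comp y
      ((hasFDerivAt_id y).prodMk (hasFDerivAt_const t y))

/-- An integral over `[0, 1]` of a jointly smooth function depends smoothly on the parameter. -/
theorem ContDiff.intervalIntegral_param [CompleteSpace V] {k : E × ℝ → V} (hk : ContDiff ℝ ∞ k) :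
    ContDiff ℝ ∞ fun x => ∫ t in (0 : ℝ)..1, k (x, t) := by
  rw [contDiff_infty]
  intro n
  induction n generalizing V with
  | zero =>
    have := hk.continuous
    refine contDiff_zero.2 (continuous_iff_continuousAt.2 fun x => ?_)
    exact (hasFDerivAt_intervalIntegral_of_contDiff (hk.of_le (by simp)) x).continuousAt
  | succ n ih =>
    refine contDiff_succ_iff_hasFDerivAt.2 ⟨_, ih (V := E →L[ℝ] V)
      (k := fun p => (fderiv ℝ k p).comp (ContinuousLinearMap.inl ℝ E ℝ)) ?_,
      hasFDerivAt_intervalIntegral_of_contDiff (hk.of_le (by simp))⟩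
    exact (contDiff_infty_iff_fderiv.1 hk).2.clm_comp contDiff_const

/-- Hadamard's lemma with parameters: `N` is the mean of the partial derivative of `f` in `z` over
the segment from `(x, 0)` to `(x, z)`. -/
theorem ContDiff.exists_hadamard [CompleteSpace V] {f : E × F → V} (hf : ContDiff ℝ ∞ f) :
    ∃ N : E × F → F →L[ℝ] V, ContDiff ℝ ∞ N ∧ ∀ x z, f (x, z) = f (x, 0) + N (x, z) z := by
  have hf' := (contDiff_infty_iff_fderiv.1 hf).2
  refine ⟨fun p => ∫ t in (0 : ℝ)..1,
    (fderiv ℝ f (p.1, t • p.2)).comp (ContinuousLinearMap.inr ℝ E F), ?_, fun x z => ?_⟩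
  · refine ContDiff.intervalIntegral_param (k := fun q : (E × F) × ℝ =>
      (fderiv ℝ f (q.1.1, q.2 • q.1.2)).comp (ContinuousLinearMap.inr ℝ E F)) ?_
    exact (hf'.comp (by fun_prop : ContDiff ℝ ∞ fun q : (E × F) × ℝ => (q.1.1, q.2 • q.1.2))
      ).clm_comp contDiff_const
  · have hc : Continuous fun t : ℝ =>
        (fderiv ℝ f (x, t • z)).comp (ContinuousLinearMap.inr ℝ E F) :=
      (hf'.continuous.comp (by fun_prop : Continuous fun t : ℝ => (x, t • z))).clm_comp
        continuous_const
    have h := intervalIntegral.integral_eq_sub_of_hasDerivAt (a := 0) (b := 1)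
      (f := fun t : ℝ => f (x, t • z))
      (f' := fun t => (fderiv ℝ f (x, t • z)).comp (ContinuousLinearMap.inr ℝ E F) z) ?_ ?_
    · rw [ContinuousLinearMap.intervalIntegral_apply (hc.intervalIntegrable _ _), h]
      simp
    · intro t _
      have h1 : HasDerivAt (fun t : ℝ => (x, t • z)) ((0 : E), (1 : ℝ) • z) t :=
        (hasDerivAt_const t x).prodMk ((hasDerivAt_id t).smul_const z)
      have h2 := ((hf.differentiable (by simp)) (x, t • z)).hasFDerivAt.comp_hasDerivAt t h1
      simpa [Function.comp_def] using h2
    · exact (hc.clm_apply continuous_const).intervalIntegrable _ _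

theorem ContDiff.exists_hadamard_zero [CompleteSpace V] {f : F → V} (hf : ContDiff ℝ ∞ f) :
    ∃ N : F → F →L[ℝ] V, ContDiff ℝ ∞ N ∧ ∀ z, f z = f 0 + N z z := by
  obtain ⟨N, hN, h⟩ := ContDiff.exists_hadamard (E := ℝ) (f := fun p : ℝ × F => f p.2)
    (hf.comp contDiff_snd)
  exact ⟨fun z => N (0, z), hN.comp (by fun_prop), fun z => h 0 z⟩

/-- A function that is smooth near a point agrees near that point with a globally smooth one. -/
theorem ContDiffOn.exists_contDiff_eventuallyEq {f : E → V} {U : Set E} {x : E}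
    (hf : ContDiffOn ℝ ∞ f U) (hU : U ∈ 𝓝 x) :
    ∃ g : E → V, ContDiff ℝ ∞ g ∧ g =ᶠ[𝓝 x] f := by
  obtain ⟨r, hr, hrU⟩ := Metric.mem_nhds_iff.1 hU
  let c : ContDiffBump x := ⟨r / 3, r / 2, by positivity, by linarith⟩
  -- `c` is supported in the ball where `f` is smooth and equals `1` near `x`
  refine ⟨fun y => c y • f y, contDiff_iff_contDiffAt.2 fun y => ?_, ?_⟩
  · by_cases hy : y ∈ Metric.ball x r
    · exact c.contDiffAt.smul
        ((hf.mono hrU).contDiffAt (Metric.isOpen_ball.mem_nhds hy))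
    · have hy' : y ∉ tsupport c := by
        rw [c.tsupport_eq]
        intro h
        apply hy
        rw [Metric.mem_closedBall] at h
        rw [Metric.mem_ball]
        have : c.rOut = r / 2 := rfl
        linarith
      have : (fun y => c y • f y) =ᶠ[𝓝 y] fun _ => 0 := by
        filter_upwards [notMem_tsupport_iff_eventuallyEq.1 hy'] with z hz
        simp [hz]
      exact contDiffAt_const.congr_of_eventuallyEq this
  · filter_upwards [c.eventuallyEq_one] with y hy
    simp [hy]

omit [FiniteDimensional ℝ F] in
/-- Inverse function theorem at the origin, in the smooth category. The source may be taken so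
small that a given property of germs holds on it. -/
theorem ContDiff.exists_isChangeOfVariables {f : E → F} (hf : ContDiff ℝ ∞ f) (f' : E ≃L[ℝ] F)
    (h' : HasFDerivAt f (f' : E →L[ℝ] F) 0) (h0 : f 0 = 0) {P : E → Prop} (hP : ∀ᶠ x in 𝓝 0, P x) :
    ∃ φ : OpenPartialHomeomorph E F, IsChangeOfVariables φ ∧ ∀ x ∈ φ.source, φ x = f x ∧ P x := by
  have hs : HasStrictFDerivAt f (f' : E →L[ℝ] F) 0 :=
    hf.contDiffAt.hasStrictFDerivAt' h' (by simp)
  have : ∀ᶠ x in 𝓝 (0 : E), P x ∧ fderiv ℝ f x ∈ range ((↑) : (E ≃L[ℝ] F) → E →L[ℝ] F) := by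
    refine hP.and (((contDiff_infty_iff_fderiv.1 hf).2.continuous.tendsto 0).eventually_mem ?_)
    rw [h'.fderiv]
    exact f'.nhds
  obtain ⟨s, hs1, hs2, hs3⟩ := eventually_nhds_iff.1 this
  -- `s` is an open set on which the derivative stays invertible and `P` holds
  let φ := hs.toOpenPartialHomeomorph f
  let χ := φ.restrOpen s hs2
  have hφ : ∀ x, χ x = f x := fun x => rfl
  have hsrc : ∀ x ∈ χ.source, x ∈ s := fun x hx => by
    simp only [χ, OpenPartialHomeomorph.restrOpen_source] at hx
    exact hx.2
  refine ⟨χ, ⟨?_, ?_, ?_, ?_⟩, fun x hx => ⟨hφ x, (hs1 x (hsrc x hx)).1⟩⟩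
  · simp only [χ, OpenPartialHomeomorph.restrOpen_source]
    exact ⟨hs.mem_toOpenPartialHomeomorph_source, hs3⟩
  · rw [hφ, h0]
  · exact hf.contDiffOn
  · intro y hy
    have hx := χ.map_target hy
    obtain ⟨e, he⟩ := (hs1 _ (hsrc _ hx)).2
    refine (χ.contDiffAt_symm hy (f₀' := e) ?_ hf.contDiffAt).contDiffWithinAt
    rw [he]
    exact (hf.differentiable (by simp) _).hasFDerivAt

/-- Existence of a globally smooth map that inverts `f` near the origin on both sides. -/
theorem ContDiff.exists_inverse_germ {f : E → F} (hf : ContDiff ℝ ∞ f) (f' : E ≃L[ℝ] F)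
    (h' : HasFDerivAt f (f' : E →L[ℝ] F) 0) (h0 : f 0 = 0) :
    ∃ g : F → E, ContDiff ℝ ∞ g ∧ g 0 = 0 ∧ (∀ᶠ y in 𝓝 0, f (g y) = y) ∧
      ∀ᶠ x in 𝓝 0, g (f x) = x := by
  obtain ⟨φ, ⟨hφ0, hφ1, -, hφ3⟩, hφ⟩ :=
    hf.exists_isChangeOfVariables f' h' h0 (P := fun _ => True) (by simp)
  have ht : φ.target ∈ 𝓝 (0 : F) := φ.open_target.mem_nhds (hφ1 ▸ φ.map_source hφ0)
  obtain ⟨g, hg, hgφ⟩ := hφ3.exists_contDiff_eventuallyEq ht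
  refine ⟨g, hg, ?_, ?_, ?_⟩
  · rw [hgφ.eq_of_nhds]
    conv_lhs => rw [← hφ1]
    exact φ.left_inv hφ0
  · filter_upwards [hgφ, ht] with y hy hyt
    rw [hy, ← (hφ _ (φ.map_target hyt)).1, φ.right_inv hyt]
  · have hf0 : Tendsto f (𝓝 0) (𝓝 0) := by simpa [h0] using hf.continuous.tendsto 0
    filter_upwards [hf0.eventually hgφ, φ.open_source.mem_nhds hφ0] with x hx hxs
    rw [hx, ← (hφ _ hxs).1, φ.left_inv hxs]

/-- Implicit function theorem at the origin, with a globally smooth implicit function. -/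
theorem ContDiff.exists_implicit_germ {G : Type} [NormedAddCommGroup G] [NormedSpace ℝ G]
    [FiniteDimensional ℝ G] {f : E × F → G} (hf : ContDiff ℝ ∞ f) (h0 : f 0 = 0) (e : F ≃L[ℝ] G)
    (he : ∀ z, fderiv ℝ f 0 (0, z) = e z) :
    ∃ ψ : E → F, ContDiff ℝ ∞ ψ ∧ ψ 0 = 0 ∧ ∀ᶠ x in 𝓝 0, f (x, ψ x) = 0 := by
  let B : E →L[ℝ] G := (fderiv ℝ f 0).comp (ContinuousLinearMap.inl ℝ E F)
  let L := (ContinuousLinearEquiv.refl ℝ E).skewProd e B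
  have hL : (L : E × F →L[ℝ] E × G) = (ContinuousLinearMap.fst ℝ E F).prod (fderiv ℝ f 0) := by
    refine ContinuousLinearMap.ext fun p => ?_
    have : fderiv ℝ f 0 p = fderiv ℝ f 0 (p.1, 0) + fderiv ℝ f 0 (0, p.2) := by
      rw [← map_add]; simp
    simp [L, B, this, he, add_comm, ContinuousLinearEquiv.skewProd_apply]
  obtain ⟨g, hg, hg0, hg1, -⟩ := ContDiff.exists_inverse_germ (f := fun p : E × F => (p.1, f p))
    (contDiff_fst.prodMk hf) L (by
      rw [hL]
      exact hasFDerivAt_fst.prodMk (hf.differentiable (by simp) 0).hasFDerivAt) (by simp [h0])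
  refine ⟨fun x => (g (x, 0)).2, contDiff_snd.comp (hg.comp (by fun_prop)), ?_, ?_⟩
  · change (g 0).2 = 0
    simp [hg0]
  · have : Tendsto (fun x : E => (x, (0 : G))) (𝓝 0) (𝓝 0) :=
      (by fun_prop : Continuous fun x : E => (x, (0 : G))).tendsto' _ _ rfl
    filter_upwards [this.eventually hg1] with x hx
    have h1 := congrArg Prod.fst hx
    have h2 := congrArg Prod.snd hx
    simp only at h1 h2
    have h3 : (x, (g (x, 0)).2) = g (x, 0) := Prod.ext h1.symm rfl
    rw [h3, h2]

end Smooth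

/-! ### Taylor expansion along lines -/

section Jets

open Filter Topology Set

variable {E F V : Type} [NormedAddCommGroup E] [NormedSpace ℝ E]
  [NormedAddCommGroup F] [NormedSpace ℝ F] [FiniteDimensional ℝ F]
  [NormedAddCommGroup V] [NormedSpace ℝ V]

theorem iteratedDeriv_comp_smul_zero {f : E → V} {k : ℕ} (hf : ContDiff ℝ k f) (v : E) :
    iteratedDeriv k (fun t : ℝ => f (t • v)) 0 = iteratedFDeriv ℝ k f 0 fun _ => v := by
  have := (ContinuousLinearMap.toSpanSingleton ℝ v).iteratedFDeriv_comp_right hf 0 le_rfl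
  rw [iteratedDeriv_eq_iteratedFDeriv]
  have h2 : (f ∘ ContinuousLinearMap.toSpanSingleton ℝ v) = fun t : ℝ => f (t • v) := by
    ext t; simp
  rw [← h2, this]
  simp

/-- Taylor's theorem along a line through the origin, up to the first nonzero term. -/
theorem tendsto_sub_div_pow_of_iteratedFDeriv_eq_zero {f : E → ℝ} {k : ℕ} (hk : k ≠ 0)
    (hf : ContDiff ℝ k f) (v : E)
    (h0 : ∀ j, 0 < j → j < k → iteratedFDeriv ℝ j f 0 (fun _ => v) = 0) :
    Tendsto (fun t : ℝ => (f (t • v) - f 0) / t ^ k) (𝓝[≠] 0)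
      (𝓝 ((k.factorial : ℝ)⁻¹ * iteratedFDeriv ℝ k f 0 fun _ => v)) := by
  have hh : ContDiff ℝ k fun t : ℝ => f (t • v) := hf.comp (by fun_prop)
  have h1 := (Real.taylor_tendsto convex_univ (mem_univ (0 : ℝ)) hh.contDiffOn)
  rw [nhdsWithin_univ] at h1
  have h2 := (h1.mono_left (nhdsWithin_le_nhds (s := {0}ᶜ))).add_const
    ((k.factorial : ℝ)⁻¹ * iteratedFDeriv ℝ k f 0 fun _ => v)
  rw [zero_add] at h2
  refine h2.congr' ?_
  filter_upwards [self_mem_nhdsWithin] with t ht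
  have ht : t ≠ 0 := ht
  rw [taylor_within_apply, Finset.sum_range_succ, Finset.sum_eq_single_of_mem 0
    (Finset.mem_range.2 (Nat.pos_of_ne_zero hk))]
  · rw [iteratedDerivWithin_univ, iteratedDerivWithin_univ, iteratedDeriv_comp_smul_zero hf]
    simp
    field_simp
    ring
  · intro j hj hj0
    rw [iteratedDerivWithin_univ, iteratedDeriv_comp_smul_zero
      (hf.of_le (by exact_mod_cast (Finset.mem_range.1 hj).le)),
      h0 j (Nat.pos_of_ne_zero hj0) (Finset.mem_range.1 hj), smul_zero]

theorem tendsto_sub_div_sq {f : E → ℝ} (hf : ContDiff ℝ ∞ f) (v : E) (h : fderiv ℝ f 0 v = 0) :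
    Tendsto (fun t : ℝ => (f (t • v) - f 0) / t ^ 2) (𝓝[≠] 0)
      (𝓝 (2⁻¹ * fderiv ℝ (fderiv ℝ f) 0 v v)) := by
  have := tendsto_sub_div_pow_of_iteratedFDeriv_eq_zero two_ne_zero
    (hf.of_le (WithTop.coe_le_coe.2 le_top)) v
    (fun j h1 h2 => by obtain rfl : j = 1 := by omega
                       simpa using h)
  simpa [iteratedFDeriv_two_apply] using this

theorem tendsto_sub_div_cube {f : E → ℝ} (hf : ContDiff ℝ ∞ f) (v : E) (h : fderiv ℝ f 0 v = 0)
    (h2 : fderiv ℝ (fderiv ℝ f) 0 v v = 0) :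
    Tendsto (fun t : ℝ => (f (t • v) - f 0) / t ^ 3) (𝓝[≠] 0)
      (𝓝 (6⁻¹ * iteratedFDeriv ℝ 3 f 0 fun _ => v)) := by
  have := tendsto_sub_div_pow_of_iteratedFDeriv_eq_zero three_ne_zero
    (hf.of_le (WithTop.coe_le_coe.2 le_top)) v
    (fun j h1 hj => by
      obtain rfl | rfl : j = 1 ∨ j = 2 := by omega
      · simpa using h
      · simpa [iteratedFDeriv_two_apply] using h2)
  simpa [Nat.factorial] using this

theorem ContDiff.fderiv_fderiv_comm {f : E → ℝ} (hf : ContDiff ℝ ∞ f) (x u v : E) :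
    fderiv ℝ (fderiv ℝ f) x u v = fderiv ℝ (fderiv ℝ f) x v u :=
  (hf.contDiffAt.isSymmSndFDerivAt
    (by simpa using (WithTop.coe_le_coe.2 le_top : ((2 : ℕ∞) : WithTop ℕ∞) ≤ ∞))).eq u v

/-- Two symmetric bilinear forms with the same diagonal agree. -/
theorem eq_of_diag_eq {B C : E →L[ℝ] E →L[ℝ] ℝ} (hB : ∀ u v, B u v = B v u)
    (hC : ∀ u v, C u v = C v u) (h : ∀ v, B v v = C v v) (u v : E) : B u v = C u v := by
  have h1 := h (u + v)
  have := h u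
  have := h v
  simp only [map_add, _root_.add_apply] at h1
  linarith [hB u v, hC u v]

end Jets

/-! ### The splitting lemma with parameters -/

section Splitting

open Filter Topology Set

variable {E F : Type} [NormedAddCommGroup E] [NormedSpace ℝ E] [FiniteDimensional ℝ E]
  [NormedAddCommGroup F] [NormedSpace ℝ F] [FiniteDimensional ℝ F]

theorem hasFDerivAt_two_smul_add_mul_self {𝔸 : Type*} [NormedRing 𝔸] [NormedAlgebra ℝ 𝔸] :
    HasFDerivAt (fun a : 𝔸 => (2 : ℝ) • a + a * a) ((2 : ℝ) • ContinuousLinearMap.id ℝ 𝔸) 0 := by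
  have := ((hasFDerivAt_id (𝕜 := ℝ) (0 : 𝔸)).const_smul (2 : ℝ)).add
    ((hasFDerivAt_id (𝕜 := ℝ) (0 : 𝔸)).mul' (hasFDerivAt_id (𝕜 := ℝ) (0 : 𝔸)))
  refine this.congr_fderiv ?_
  ext a
  simp

/-- The square root of `1 + B`, as a smooth germ. If `1 + B` is self-adjoint with respect to the
nondegenerate form `H`, then so is its square root, since `1 + B` has only one square root
near `1`. -/
theorem exists_sqrt_germ (H : F ≃L[ℝ] (F →L[ℝ] ℝ)) :
    ∃ R : (F →L[ℝ] F) → (F →L[ℝ] F), ContDiff ℝ ∞ R ∧ R 0 = 0 ∧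
      ∀ᶠ B in 𝓝 0, (∀ u v, H (B u) v = H u (B v)) →
        ∀ z, H (z + R B z) (z + R B z) = H (z + B z) z := by
  -- `1 + R B` is the square root of `1 + B` when `R` inverts `A ↦ (1 + A)² - 1`
  let sq : (F →L[ℝ] F) → (F →L[ℝ] F) := fun A => (2 : ℝ) • A + A * A
  have hsq : ContDiff ℝ ∞ sq := (contDiff_id.const_smul (2 : ℝ)).add (contDiff_id.mul contDiff_id)
  have hsq0 : sq 0 = 0 := by simp [sq]
  have hd : HasFDerivAt sq
      ((ContinuousLinearEquiv.smulLeft (Units.mk0 (2 : ℝ) two_ne_zero) :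
        (F →L[ℝ] F) ≃L[ℝ] (F →L[ℝ] F)) : (F →L[ℝ] F) →L[ℝ] (F →L[ℝ] F)) 0 := by
    exact (hasFDerivAt_two_smul_add_mul_self (𝔸 := F →L[ℝ] F)).congr_fderiv
      (ContinuousLinearMap.ext fun A => rfl)
  obtain ⟨R, hR, hR0, hR1, hR2⟩ := hsq.exists_inverse_germ _ hd hsq0
  -- the adjoint with respect to `H`
  let ad : (F →L[ℝ] F) → (F →L[ℝ] F) := fun A =>
    (H.symm : (F →L[ℝ] ℝ) →L[ℝ] F).comp
      (((ContinuousLinearMap.compL ℝ F F ℝ).flip A).comp (H : F →L[ℝ] (F →L[ℝ] ℝ)))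
  have had : ∀ A u v, H (ad A u) v = H u (A v) := fun A u v => by simp [ad]
  have had_unique : ∀ A B : F →L[ℝ] F, (∀ u v, H (B u) v = H u (A v)) → B = ad A := by
    intro A B h
    ext1 u
    apply H.injective
    ext v
    rw [h, had]
  have hadc : Continuous ad := by
    refine continuous_const.clm_comp (Continuous.clm_comp ?_ continuous_const)
    exact ((ContinuousLinearMap.compL ℝ F F ℝ).flip).continuous
  have had0 : ad 0 = 0 := (had_unique 0 0 (by simp)).symm
  have had_sq : ∀ A, ad (sq A) = sq (ad A) := fun A => by
    refine (had_unique _ _ fun u v => ?_).symm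
    simp [sq, had]
  refine ⟨R, hR, hR0, ?_⟩
  have ht : Tendsto R (𝓝 0) (𝓝 0) := hR.continuous.tendsto' _ _ hR0
  have ht2 : Tendsto (fun B => ad (R B)) (𝓝 0) (𝓝 0) := (hadc.tendsto' _ _ had0).comp ht
  filter_upwards [hR1, ht2.eventually hR2] with B hB1 hB2 hBs z
  -- `R B` and its adjoint are both small solutions of `sq A = B`
  have hself : ad (R B) = R B := by
    rw [← had_sq, hB1, ← had_unique B B hBs] at hB2
    exact hB2.symm
  have hs : ∀ u v, H (R B u) v = H u (R B v) := fun u v => by rw [← had, hself]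
  have hB3 : B z = (2 : ℝ) • R B z + R B (R B z) := by
    conv_lhs => rw [← hB1]
    simp [sq]
  rw [hB3]
  simp only [map_add, map_smul, _root_.add_apply, _root_.smul_apply,
    hs]
  simp only [smul_eq_mul]
  ring

/-- The splitting lemma with parameters: if the partial Hessian `H` of `f` in the variable `z ∈ F`
is nondegenerate at the origin, then near the origin `f (x, z) = f (x, ψ x) + ½ H (w, w)`, where
`z ↦ w (x, z)` is a change of variables for every `x`. -/
theorem exists_splitting {f : E × F → ℝ} (hf : ContDiff ℝ ∞ f)
    (h1 : ∀ z, fderiv ℝ f 0 (0, z) = 0) (H : F ≃L[ℝ] (F →L[ℝ] ℝ))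
    (hH : ∀ k l, fderiv ℝ (fderiv ℝ f) 0 (0, k) (0, l) = H k l) :
    ∃ (ψ : E → F) (w : E × F → F) (w' : E × F →L[ℝ] F), ContDiff ℝ ∞ ψ ∧ ψ 0 = 0 ∧
      ContDiff ℝ ∞ w ∧ w 0 = 0 ∧ HasFDerivAt w w' 0 ∧
      (∀ p l, H (w' p) l = fderiv ℝ (fderiv ℝ f) 0 p (0, l)) ∧
      ∀ᶠ p in 𝓝 0, f p = f (p.1, ψ p.1) + 2⁻¹ * H (w p) (w p) := by
  have hf' := (contDiff_infty_iff_fderiv.1 hf).2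
  have hHs : ∀ u v, H u v = H v u := fun u v => by rw [← hH, ← hH, hf.fderiv_fderiv_comm]
  -- the critical point of `f (x, ·)` near the origin
  let df : E × F → F →L[ℝ] ℝ := fun p => (fderiv ℝ f p).comp (ContinuousLinearMap.inr ℝ E F)
  have hdf : ContDiff ℝ ∞ df := hf'.clm_comp contDiff_const
  have hdfd : ∀ p l, fderiv ℝ df 0 p l = fderiv ℝ (fderiv ℝ f) 0 p (0, l) := by
    intro p l
    have h := ((hf'.differentiable (by simp) 0).hasFDerivAt.clm_comp
      (hasFDerivAt_const (ContinuousLinearMap.inr ℝ E F) (0 : E × F))).fderiv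
    have h2 : fderiv ℝ df 0 = _ := h
    rw [h2]
    simp
  obtain ⟨ψ, hψ, hψ0, hψ1⟩ := hdf.exists_implicit_germ (by ext z; exact h1 z) H
    (fun z => by ext l; rw [hdfd, hH])
  -- the first derivative of `ψ`
  have hψd : ∀ h l, fderiv ℝ (fderiv ℝ f) 0 (h, 0) (0, l) = - H (fderiv ℝ ψ 0 h) l := by
    intro h l
    have e1 : HasFDerivAt (fun x => df (x, ψ x)) ((fderiv ℝ df 0).comp
        ((ContinuousLinearMap.id ℝ E).prod (fderiv ℝ ψ 0))) 0 := by
      have hd0 : HasFDerivAt df (fderiv ℝ df 0) ((0 : E), ψ 0) := by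
        rw [hψ0]; exact (hdf.differentiable (by simp) 0).hasFDerivAt
      exact hd0.comp 0 ((hasFDerivAt_id _).prodMk (hψ.differentiable (by simp) 0).hasFDerivAt)
    have e2 := (e1.congr_of_eventuallyEq (f₁ := fun _ => 0)
      (by filter_upwards [hψ1] with x hx using hx.symm)).unique (hasFDerivAt_const _ _)
    have e3 := congrArg (fun A : E →L[ℝ] F →L[ℝ] ℝ => A h l) e2
    simp only [ContinuousLinearMap.comp_apply, ContinuousLinearMap.prod_apply, hdfd,
      ContinuousLinearMap.id_apply, _root_.zero_apply] at e3
    have e4 : (h, fderiv ℝ ψ 0 h) = ((h, 0) : E × F) + (0, fderiv ℝ ψ 0 h) := by simp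
    rw [e4, map_add, _root_.add_apply, hH] at e3
    linarith
  -- move the critical point to `z = 0` and apply Hadamard's lemma twice
  let g : E × F → ℝ := fun p => f (p.1, p.2 + ψ p.1)
  have hg : ContDiff ℝ ∞ g :=
    hf.comp (contDiff_fst.prodMk (contDiff_snd.add (hψ.comp contDiff_fst)))
  obtain ⟨N, hN, hgN⟩ := hg.exists_hadamard
  obtain ⟨M, hM, hNM⟩ := hN.exists_hadamard
  -- `N (x, 0)` is the partial derivative of `f` at `(x, ψ x)`
  have hN0 : ∀ᶠ x in 𝓝 (0 : E), N (x, 0) = 0 := by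
    filter_upwards [hψ1] with x hx
    have a1 : HasFDerivAt (fun z => g (x, z)) (df (x, ψ x)) 0 := by
      have hfd : HasFDerivAt f (fderiv ℝ f (x, ψ x)) (x, (0 : F) + ψ x) := by
        rw [zero_add]; exact (hf.differentiable (by simp) _).hasFDerivAt
      have hi : HasFDerivAt (fun z : F => (x, z + ψ x)) (ContinuousLinearMap.inr ℝ E F) 0 :=
        (hasFDerivAt_const x _).prodMk ((hasFDerivAt_id _).add_const _)
      exact hfd.comp (0 : F) hi
    have a2 : HasFDerivAt (fun z => g (x, z)) (N (x, 0)) 0 := by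
      have b1 : HasFDerivAt (fun z => N (x, z)) (fderiv ℝ (fun z => N (x, z)) 0) 0 :=
        ((hN.comp (by fun_prop : ContDiff ℝ ∞ fun z : F => (x, z))).differentiable
          (by simp) 0).hasFDerivAt
      have b2 := (b1.clm_apply (hasFDerivAt_id (0 : F))).const_add (g (x, 0))
      refine (b2.congr_of_eventuallyEq (Eventually.of_forall fun z => hgN x z)).congr_fderiv ?_
      ext z
      simp
    rw [← a1.unique a2] at *
    exact hx
  -- only the symmetric part of `M` matters
  let S : E × F → F →L[ℝ] F →L[ℝ] ℝ := fun p => M p + (M p).flip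
  have hS : ContDiff ℝ ∞ S :=
    hM.add (contDiff_clm_apply_iff.2 fun _ => contDiff_clm_apply_iff.2 fun _ =>
      (hM.clm_apply contDiff_const).clm_apply contDiff_const)
  have hSs : ∀ p u v, S p u v = S p v u := fun p u v => by simp [S, add_comm]
  have hfst : Tendsto (Prod.fst : E × F → E) (𝓝 0) (𝓝 0) := continuous_fst.tendsto _
  have hgS : ∀ᶠ p : E × F in 𝓝 0, g p = f (p.1, ψ p.1) + 2⁻¹ * S p p.2 p.2 := by
    filter_upwards [hfst.eventually hN0] with p hp
    have := hgN p.1 p.2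
    rw [hNM, hp, zero_add] at this
    simp only [Prod.mk.eta] at this
    rw [this]
    simp only [g, S, _root_.add_apply, ContinuousLinearMap.flip_apply, zero_add]
    ring
  have hS0 : ∀ u v, S 0 u v = H u v := by
    refine eq_of_diag_eq (C := (H : F →L[ℝ] F →L[ℝ] ℝ)) (hSs 0) hHs fun z => ?_
    have t1 := tendsto_sub_div_sq hf (0, z) (h1 z)
    rw [hH] at t1
    have hl : Tendsto (fun t : ℝ => t • ((0 : E), z)) (𝓝[≠] 0) (𝓝 0) :=
      ((by fun_prop : Continuous fun t : ℝ => t • ((0 : E), z)).tendsto' _ _ (by simp)).mono_left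
        nhdsWithin_le_nhds
    have t2 : Tendsto (fun t : ℝ => 2⁻¹ * S (t • ((0 : E), z)) z z) (𝓝[≠] 0)
        (𝓝 (2⁻¹ * S 0 z z)) := by
      have hc : Continuous fun p => 2⁻¹ * S p z z :=
        continuous_const.mul ((hS.continuous.clm_apply continuous_const).clm_apply continuous_const)
      exact (hc.tendsto 0).comp hl
    have t3 := tendsto_nhds_unique (t1.congr' ?_) t2
    · exact (mul_left_cancel₀ (by norm_num) t3).symm
    · filter_upwards [hl.eventually hgS, self_mem_nhdsWithin] with t ht ht0
      have ht0 : t ≠ 0 := ht0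
      simp only [g, Prod.smul_mk, smul_zero, hψ0, add_zero, map_smul,
        _root_.smul_apply, smul_eq_mul] at ht ⊢
      rw [ht]
      have : f (0, 0) = f 0 := rfl
      rw [this]
      field_simp
      ring
  -- the square root of `H⁻¹ S` turns `S` into the constant form `H`
  obtain ⟨R, hR, hR0, hR1⟩ := exists_sqrt_germ H
  let B : E × F → F →L[ℝ] F := fun p =>
    (H.symm : (F →L[ℝ] ℝ) →L[ℝ] F).comp (S p) - ContinuousLinearMap.id ℝ F
  have hB : ContDiff ℝ ∞ B := (contDiff_const.clm_comp hS).sub contDiff_const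
  have hHB : ∀ p u, H (B p u) = S p u - H u := fun p u => by simp [B]
  have hB0 : B 0 = 0 := by
    ext1 u
    apply H.injective
    ext v
    simp [hHB, hS0]
  let τ : E × F → E × F := fun p => (p.1, p.2 - ψ p.1)
  have hτ : ContDiff ℝ ∞ τ := contDiff_fst.prodMk (contDiff_snd.sub (hψ.comp contDiff_fst))
  have hτ0 : τ 0 = 0 := by simp [τ, hψ0]
  have hτt : Tendsto τ (𝓝 0) (𝓝 0) := hτ.continuous.tendsto' _ _ hτ0
  have hRB : ContDiff ℝ ∞ fun p => R (B (τ p)) := hR.comp (hB.comp hτ)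
  refine ⟨ψ, fun p => (τ p).2 + R (B (τ p)) (τ p).2,
    ContinuousLinearMap.snd ℝ E F - (fderiv ℝ ψ 0).comp (ContinuousLinearMap.fst ℝ E F),
    hψ, hψ0, ?_, ?_, ?_, ?_, ?_⟩
  · exact (contDiff_snd.comp hτ).add (hRB.clm_apply (contDiff_snd.comp hτ))
  · simp [hτ0]
  · have c1 : HasFDerivAt (fun p => (τ p).2) (ContinuousLinearMap.snd ℝ E F -
        (fderiv ℝ ψ 0).comp (ContinuousLinearMap.fst ℝ E F)) 0 := by
      have : HasFDerivAt ψ (fderiv ℝ ψ 0) (0 : E × F).1 :=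
        (hψ.differentiable (by simp) _).hasFDerivAt
      exact hasFDerivAt_snd.sub (this.comp 0 hasFDerivAt_fst)
    have c2 := c1.add ((hRB.differentiable (by simp) 0).hasFDerivAt.clm_apply c1)
    refine c2.congr_fderiv ?_
    ext1 <;> ext1 <;> simp [hτ0, hB0, hR0]
  · rintro ⟨h, k⟩ l
    have e4 : (h, k) = ((h, 0) : E × F) + (0, k) := by simp
    rw [e4, map_add (fderiv ℝ (fderiv ℝ f) 0), _root_.add_apply, hψd, hH]
    simp
    ring
  · have hBt : Tendsto (fun p => B (τ p)) (𝓝 0) (𝓝 0) :=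
      (hB.continuous.tendsto' _ _ hB0).comp hτt
    filter_upwards [hτt.eventually hgS, hBt.eventually hR1] with p hp1 hp2
    rw [hp2 fun u v => ?_]
    · rw [map_add, hHB, add_sub_cancel, ← hp1]
      simp [g, τ]
    · rw [hHs u, hHB, hHB]
      simp [hSs _ u v, hHs u v]

end Splitting

/-! ### Cubic leading terms -/

/-- The function `c` is the leading term, of degree three, of `g - g 0` at the origin, tested along
lines. -/
def HasCubicLeadingTerm {E : Type} [NormedAddCommGroup E] [NormedSpace ℝ E] (g c : E → ℝ) : Prop :=
  ∀ v, Filter.Tendsto (fun t : ℝ => (g (t • v) - g 0) / t ^ 3) (nhdsWithin 0 {0}ᶜ) (nhds (c v))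

section Leading

set_option maxSynthPendingDepth 3

open Filter Topology Set

variable {F : Type} [NormedAddCommGroup F] [NormedSpace ℝ F] [FiniteDimensional ℝ F]

theorem tendsto_id_punctured : Tendsto (fun t : ℝ => t) (𝓝[≠] 0) (𝓝 0) :=
  tendsto_id.mono_left nhdsWithin_le_nhds

omit [FiniteDimensional ℝ F] in
theorem tendsto_smul_punctured (v : F) : Tendsto (fun t : ℝ => t • v) (𝓝[≠] 0) (𝓝 0) := by
  simpa using tendsto_id_punctured.smul_const v

/-- A smooth function with a cubic leading term is a cubic expression with smooth coefficients. -/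
theorem HasCubicLeadingTerm.exists_cubic_remainder {g c : F → ℝ} (hc : HasCubicLeadingTerm g c)
    (hg : ContDiff ℝ ∞ g) :
    ∃ K : F → F →L[ℝ] F →L[ℝ] F →L[ℝ] ℝ, ContDiff ℝ ∞ K ∧ (∀ z, g z = g 0 + K z z z z) ∧
      ∀ v, K 0 v v v = c v := by
  -- apply Hadamard's lemma three times; the lower order coefficients vanish at `0`
  obtain ⟨N, hN, hgN⟩ := hg.exists_hadamard_zero
  have lim0 : ∀ v, Tendsto (fun t : ℝ => (g (t • v) - g 0) / t ^ 3 * t ^ 2) (𝓝[≠] 0) (𝓝 0) :=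
    fun v => by simpa using (hc v).mul (tendsto_id_punctured.pow 2)
  have lim1 : ∀ v, Tendsto (fun t : ℝ => (g (t • v) - g 0) / t ^ 3 * t) (𝓝[≠] 0) (𝓝 0) :=
    fun v => by simpa using (hc v).mul tendsto_id_punctured
  have hN0 : N 0 = 0 := by
    ext v
    have h2 : Tendsto (fun t : ℝ => N (t • v) v) (𝓝[≠] 0) (𝓝 (N 0 v)) :=
      ((hN.continuous.clm_apply continuous_const).tendsto 0).comp (tendsto_smul_punctured v)
    refine tendsto_nhds_unique (h2.congr' ?_) (lim0 v)
    filter_upwards [self_mem_nhdsWithin] with t ht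
    have ht : t ≠ 0 := ht
    rw [hgN (t • v)]
    simp
    field_simp
  obtain ⟨M, hM, hNM⟩ := hN.exists_hadamard_zero
  -- `M 0` need not be symmetric, but its quadratic form vanishes
  have hM0 : ∀ v, M 0 v v = 0 := by
    intro v
    have h2 : Tendsto (fun t : ℝ => M (t • v) v v) (𝓝[≠] 0) (𝓝 (M 0 v v)) :=
      (((hM.continuous.clm_apply continuous_const).clm_apply continuous_const).tendsto 0).comp
        (tendsto_smul_punctured v)
    refine tendsto_nhds_unique (h2.congr' ?_) (lim1 v)
    filter_upwards [self_mem_nhdsWithin] with t ht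
    have ht : t ≠ 0 := ht
    rw [hgN (t • v), hNM (t • v), hN0]
    simp
    field_simp
  obtain ⟨K, hK, hMK⟩ := hM.exists_hadamard_zero
  have hgK : ∀ z, g z = g 0 + K z z z z := fun z => by
    conv_lhs => rw [hgN, hNM, hMK, hN0]
    simp [hM0]
  refine ⟨K, hK, hgK, fun v => ?_⟩
  have h2 : Tendsto (fun t : ℝ => K (t • v) v v v) (𝓝[≠] 0) (𝓝 (K 0 v v v)) :=
    ((((hK.continuous.clm_apply continuous_const).clm_apply continuous_const).clm_apply
      continuous_const).tendsto 0).comp (tendsto_smul_punctured v)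
  refine tendsto_nhds_unique (h2.congr' ?_) (hc v)
  filter_upwards [self_mem_nhdsWithin] with t ht
  have ht : t ≠ 0 := ht
  rw [hgK (t • v)]
  simp
  field_simp

/-- The cubic leading term can be read off along any curve with the given velocity. -/
theorem HasCubicLeadingTerm.tendsto_curve {g c : F → ℝ} (hc : HasCubicLeadingTerm g c)
    (hg : ContDiff ℝ ∞ g) {γ : ℝ → F} {v : F}
    (hγ : Tendsto (fun t : ℝ => t⁻¹ • γ t) (𝓝[≠] 0) (𝓝 v)) :
    Tendsto (fun t : ℝ => (g (γ t) - g 0) / t ^ 3) (𝓝[≠] 0) (𝓝 (c v)) := by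
  obtain ⟨K, hK, hgK, hK0⟩ := hc.exists_cubic_remainder hg
  have hγ0 : Tendsto γ (𝓝[≠] 0) (𝓝 0) := by
    have := tendsto_id_punctured.smul hγ
    rw [zero_smul] at this
    refine this.congr' ?_
    filter_upwards [self_mem_nhdsWithin] with t ht
    exact smul_inv_smul₀ ht _
  have hG : Continuous fun p : F × F => K p.1 p.2 p.2 p.2 :=
    (((hK.continuous.comp continuous_fst).clm_apply continuous_snd).clm_apply
      continuous_snd).clm_apply continuous_snd
  rw [← hK0]
  refine ((hG.tendsto (0, v)).comp (hγ0.prodMk_nhds hγ)).congr' ?_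
  filter_upwards [self_mem_nhdsWithin] with t ht
  have ht : t ≠ 0 := ht
  rw [hgK (γ t)]
  simp
  field_simp

end Leading

/-! ### Normal form of a function of two variables with a cubic leading term -/

section Planar

open Filter Topology Set

set_option maxSynthPendingDepth 3

/-- Multiplication by a nonzero real number, as a linear equivalence. -/
noncomputable def mulEquiv (a : ℝ) (ha : a ≠ 0) : ℝ ≃L[ℝ] ℝ :=
  ContinuousLinearEquiv.smulLeft (Units.mk0 a ha)

theorem mulEquiv_apply (a : ℝ) (ha : a ≠ 0) (x : ℝ) : mulEquiv a ha x = a * x := rfl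

theorem ContinuousLinearMap.apply_real_prod (L : ℝ × ℝ →L[ℝ] ℝ) (p : ℝ × ℝ) :
    L p = p.1 * L (1, 0) + p.2 * L (0, 1) := by
  have : p = p.1 • (1, 0) + p.2 • (0, 1) := by ext <;> simp
  conv_lhs => rw [this]
  simp only [map_add, map_smul, smul_eq_mul]

theorem ContinuousLinearMap.apply_apply_real_prod (B : ℝ × ℝ →L[ℝ] ℝ × ℝ →L[ℝ] ℝ) (p q : ℝ × ℝ) :
    B p q = p.1 * q.1 * B (1, 0) (1, 0) + p.1 * q.2 * B (1, 0) (0, 1) +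
      p.2 * q.1 * B (0, 1) (1, 0) + p.2 * q.2 * B (0, 1) (0, 1) := by
  have : p = p.1 • (1, 0) + p.2 • (0, 1) := by ext <;> simp
  conv_lhs => rw [this]
  simp only [map_add, map_smul, smul_eq_mul, _root_.add_apply, _root_.smul_apply]
  rw [apply_real_prod _ q, apply_real_prod (B (0, 1)) q]
  ring

theorem ContinuousLinearMap.apply_real (L : ℝ →L[ℝ] ℝ) (x : ℝ) : L x = x * L 1 := by
  conv_lhs => rw [← mul_one x, ← smul_eq_mul, map_smul, smul_eq_mul]

/-- A simple root of the cubic leading term, here the line `y = 0`, is tangent to a smooth branch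
of the level set. In the blow-up chart `y = x u` the branch is found by the implicit function
theorem. -/
theorem HasCubicLeadingTerm.exists_branch {g : ℝ × ℝ → ℝ} (hg : ContDiff ℝ ∞ g) {α β γ : ℝ}
    (hα : α ≠ 0) (hc : HasCubicLeadingTerm g
      fun p => α * p.1 ^ 2 * p.2 + β * p.1 * p.2 ^ 2 + γ * p.2 ^ 3) :
    ∃ u : ℝ → ℝ, ContDiff ℝ ∞ u ∧ u 0 = 0 ∧ ∀ᶠ x in 𝓝 0, g (x, x * u x) = g 0 := by
  obtain ⟨K, hK, hgK, hK0⟩ := hc.exists_cubic_remainder hg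
  -- `g (x, x u) = g 0 + x³ G (x, u)`
  let G : ℝ × ℝ → ℝ := fun p => K (p.1, p.1 * p.2) (1, p.2) (1, p.2) (1, p.2)
  have hl : ContDiff ℝ ∞ fun p : ℝ × ℝ => ((1 : ℝ), p.2) := by fun_prop
  have hG : ContDiff ℝ ∞ G :=
    (((hK.comp (by fun_prop : ContDiff ℝ ∞ fun p : ℝ × ℝ => (p.1, p.1 * p.2))).clm_apply
      hl).clm_apply hl).clm_apply hl
  have hG0 : ∀ u, G (0, u) = α * u + β * u ^ 2 + γ * u ^ 3 := fun u => by
    have := hK0 (1, u)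
    simp only [G, zero_mul]
    rw [show ((0 : ℝ), (0 : ℝ)) = 0 from rfl, this]
    simp
  have hd : fderiv ℝ G 0 (0, 1) = α := by
    have h1 : HasDerivAt (fun u => G (0, u)) (fderiv ℝ G 0 (0, 1)) 0 :=
      (hG.differentiable (by simp) 0).hasFDerivAt.comp_hasDerivAt (0 : ℝ)
        ((hasDerivAt_const (0 : ℝ) (0 : ℝ)).prodMk (hasDerivAt_id (0 : ℝ)))
    have h2 : HasDerivAt (fun u => G (0, u)) α 0 := by
      simp only [hG0]
      have := (((hasDerivAt_id (0 : ℝ)).const_mul α).add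
        (((hasDerivAt_id (0 : ℝ)).pow 2).const_mul β)).add
        (((hasDerivAt_id (0 : ℝ)).pow 3).const_mul γ)
      simpa [Pi.add_def] using this
    exact h1.unique h2
  obtain ⟨u, hu, hu0, hu1⟩ := hG.exists_implicit_germ (by simpa [Prod.zero_eq_mk] using hG0 0) (mulEquiv α hα)
    (fun z => by
      rw [mulEquiv_apply, ← hd, ContinuousLinearMap.apply_real_prod]
      simp [mul_comm])
  refine ⟨u, hu, hu0, ?_⟩
  filter_upwards [hu1] with x hx
  have h3 : (x, x * u x) = x • ((1 : ℝ), u x) := by simp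
  simp only [G] at hx
  rw [hgK, add_eq_left]
  rw [h3] at hx ⊢
  simp only [map_smul, _root_.smul_apply, hx, smul_zero]

/-- A function with cubic leading term `y (α x² + β x y + γ y²)`, `α ≠ 0`, is, up to an additive
constant, the product of a smooth function `η` with linear part `y` and of a smooth function of
`η` and `x` with leading term `α x² + β x η + γ η²`. -/
theorem HasCubicLeadingTerm.exists_factorization {g : ℝ × ℝ → ℝ} (hg : ContDiff ℝ ∞ g)
    {α β γ : ℝ} (hα : α ≠ 0) (hc : HasCubicLeadingTerm g
      fun p => α * p.1 ^ 2 * p.2 + β * p.1 * p.2 ^ 2 + γ * p.2 ^ 3) :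
    ∃ (u : ℝ → ℝ) (q : ℝ × ℝ → ℝ), ContDiff ℝ ∞ u ∧ u 0 = 0 ∧ ContDiff ℝ ∞ q ∧ q 0 = 0 ∧
      fderiv ℝ q 0 = 0 ∧
      (∀ p, fderiv ℝ (fderiv ℝ q) 0 p p = 2 * (α * p.2 ^ 2 + β * p.2 * p.1 + γ * p.1 ^ 2)) ∧
      ∀ᶠ p : ℝ × ℝ in 𝓝 0,
        g p = g 0 + (p.2 - p.1 * u p.1) * q (p.2 - p.1 * u p.1, p.1) := by
  obtain ⟨u, hu, hu0, hu1⟩ := hc.exists_branch hg hα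
  obtain ⟨N, hN, hgN⟩ := ContDiff.exists_hadamard (f := fun p : ℝ × ℝ => g (p.1, p.2 + p.1 * u p.1))
    (hg.comp (by fun_prop))
  let q : ℝ × ℝ → ℝ := fun p => N (p.2, p.1) 1
  have hq : ContDiff ℝ ∞ q :=
    (hN.comp (by fun_prop : ContDiff ℝ ∞ fun p : ℝ × ℝ => (p.2, p.1))).clm_apply contDiff_const
  have hgq : ∀ x y, g (x, x * u x) = g 0 → g (x, y + x * u x) = g 0 + y * q (y, x) := by
    intro x y hx
    have := hgN x y
    simp only [zero_add, hx] at this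
    rw [this, ContinuousLinearMap.apply_real]
  -- the second order behaviour of `q` along lines transversal to `η = 0`
  have hlim : ∀ x y : ℝ, y ≠ 0 → Tendsto (fun t : ℝ => q (t • (y, x)) / t ^ 2) (𝓝[≠] 0)
      (𝓝 (α * x ^ 2 + β * x * y + γ * y ^ 2)) := by
    intro x y hy
    have htx : Tendsto (fun t : ℝ => t * x) (𝓝[≠] 0) (𝓝 0) := by
      simpa using tendsto_id_punctured.mul_const x
    have hcurve : Tendsto (fun t : ℝ => t⁻¹ • (t * x, t * y + t * x * u (t * x))) (𝓝[≠] 0)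
        (𝓝 (x, y)) := by
      have h1 : Tendsto (fun t : ℝ => (x, y + x * u (t * x))) (𝓝[≠] 0) (𝓝 (x, y)) := by
        refine tendsto_const_nhds.prodMk_nhds ?_
        have := (((hu.continuous.tendsto 0).comp htx).const_mul x).const_add y
        simpa [hu0] using this
      refine h1.congr' ?_
      filter_upwards [self_mem_nhdsWithin] with t ht
      have ht : t ≠ 0 := ht
      ext <;> simp <;> field_simp
    have h2 := (hc.tendsto_curve hg hcurve).div_const y
    have h3 : (α * x ^ 2 * y + β * x * y ^ 2 + γ * y ^ 3) / y =
        α * x ^ 2 + β * x * y + γ * y ^ 2 := by field_simp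
    simp only [h3] at h2
    refine h2.congr' ?_
    filter_upwards [self_mem_nhdsWithin, htx.eventually hu1] with t ht h4
    have ht : t ≠ 0 := ht
    rw [hgq _ _ h4]
    simp
    field_simp
  have hq0 : q 0 = 0 := by
    have h1 := (hlim 0 1 one_ne_zero).mul (tendsto_id_punctured.pow 2)
    have h2 : Tendsto (fun t : ℝ => q (t • ((1 : ℝ), (0 : ℝ)))) (𝓝[≠] 0) (𝓝 (q 0)) :=
      (hq.continuous.tendsto 0).comp (tendsto_smul_punctured _)
    refine tendsto_nhds_unique h2 ?_
    simp only [ne_eq, OfNat.ofNat_ne_zero, not_false_eq_true, zero_pow, mul_zero] at h1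
    refine h1.congr' ?_
    filter_upwards [self_mem_nhdsWithin] with t ht
    have ht : t ≠ 0 := ht
    field_simp
  have hq1' : ∀ x : ℝ, fderiv ℝ q 0 (1, x) = 0 := by
    intro x
    have h1 := (hlim x 1 one_ne_zero).mul tendsto_id_punctured
    have h2 := tendsto_sub_div_pow_of_iteratedFDeriv_eq_zero one_ne_zero (hq.of_le (by simp))
      ((1 : ℝ), x) (fun j h h' => by omega)
    simp only [hq0, Nat.factorial_one, Nat.cast_one, inv_one, one_mul, iteratedFDeriv_one_apply,
      mul_zero] at h1 h2
    refine tendsto_nhds_unique h2 (h1.congr' ?_)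
    filter_upwards [self_mem_nhdsWithin] with t ht
    have ht : t ≠ 0 := ht
    field_simp
    simp
  have hq1 : fderiv ℝ q 0 = 0 := by
    refine ContinuousLinearMap.ext fun p => ?_
    have h0 := hq1' 0
    have h1 := hq1' 1
    rw [ContinuousLinearMap.apply_real_prod] at h1
    rw [ContinuousLinearMap.apply_real_prod, h0]
    simp only [h0] at h1
    simp only [mul_zero, one_mul, zero_add] at h1
    simp [h1]
  have hq2' : ∀ x : ℝ, fderiv ℝ (fderiv ℝ q) 0 (1, x) (1, x) = 2 * (α * x ^ 2 + β * x + γ) := by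
    intro x
    have h1 := tendsto_sub_div_sq hq ((1 : ℝ), x) (by simp [hq1])
    simp only [hq0, sub_zero] at h1
    have := tendsto_nhds_unique h1 (hlim x 1 one_ne_zero)
    simp only [mul_one, one_pow] at this
    linarith
  refine ⟨u, q, hu, hu0, hq, hq0, hq1, fun p => ?_, ?_⟩
  · have a0 := hq2' 0
    have a1 := hq2' 1
    have a2 := hq2' (-1)
    have hs := hq.fderiv_fderiv_comm 0 ((0 : ℝ), (1 : ℝ)) ((1 : ℝ), (0 : ℝ))
    rw [ContinuousLinearMap.apply_apply_real_prod] at a1 a2 ⊢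
    rw [hs] at a1 a2 ⊢
    have b1 : fderiv ℝ (fderiv ℝ q) 0 (1, 0) (0, 1) = β := by linarith
    have b2 : fderiv ℝ (fderiv ℝ q) 0 (0, 1) (0, 1) = 2 * α := by linarith
    rw [b1, b2, a0]
    ring
  · have : Tendsto (Prod.fst : ℝ × ℝ → ℝ) (𝓝 0) (𝓝 0) := continuous_fst.tendsto _
    filter_upwards [this.eventually hu1] with p hp
    have := hgq p.1 (p.2 - p.1 * u p.1) hp
    rwa [sub_add_cancel] at this

/-- Smooth factors `a`, `b` with `(x b)² (y a) + e (y a)³ = α x² y + s y³`. -/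
theorem exists_rescaling {s : ℝ → ℝ} (hs : ContDiff ℝ ∞ s) {α e : ℝ} (h : 0 < e * α * s 0) :
    ∃ a b : ℝ → ℝ, ContDiff ℝ ∞ a ∧ ContDiff ℝ ∞ b ∧
      ∀ᶠ y in 𝓝 0, b y ^ 2 * a y = α ∧ e * a y ^ 3 = s y := by
  have he : e ≠ 0 := by rintro rfl; simp at h
  have hα : α ≠ 0 := by rintro rfl; simp at h
  let m : ℝ → ℝ := fun y => s y / (e * α ^ 3)
  have hm : ContDiff ℝ ∞ m := hs.div_const _
  have hm0 : 0 < m 0 := by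
    have : m 0 = e * α * s 0 / (e ^ 2 * α ^ 4) := by simp only [m]; field_simp
    rw [this]; positivity
  have hU : {y | 0 < m y} ∈ 𝓝 (0 : ℝ) := (hm.continuous.tendsto 0).eventually (lt_mem_nhds hm0)
  have hr : ∀ p : ℝ, ContDiffOn ℝ ∞ (fun y => m y ^ p) {y | 0 < m y} := fun p =>
    hm.contDiffOn.rpow_const_of_ne fun y hy => (ne_of_gt hy)
  -- `b = m ^ (-1/6)` and `a = α / b ^ 2`
  obtain ⟨b, hb, hbm⟩ := (hr (-1 / 6)).exists_contDiff_eventuallyEq hU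
  obtain ⟨a, ha, ham⟩ :=
    (contDiffOn_const (c := α).mul (hr (1 / 3))).exists_contDiff_eventuallyEq hU
  refine ⟨a, b, ha, hb, ?_⟩
  filter_upwards [hbm, ham, hU] with y hby hay hy
  have hy : 0 < m y := hy
  rw [hby, hay]
  constructor
  · rw [← Real.rpow_natCast, ← Real.rpow_mul hy.le, mul_left_comm, ← Real.rpow_add hy]
    norm_num
  · rw [mul_pow, ← Real.rpow_natCast (m y ^ (1 / 3 : ℝ)), ← Real.rpow_mul hy.le]
    norm_num
    simp only [m]
    field_simp

/-- A function of two variables whose cubic leading term is `y (α x² + β x y + γ y²)`, with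
nonzero discriminant, is brought to the form `X² Y + e Y³` for every `e` of the right sign. -/
theorem HasCubicLeadingTerm.exists_planar_normal_form {g : ℝ × ℝ → ℝ} (hg : ContDiff ℝ ∞ g)
    {α β γ e : ℝ} (hα : α ≠ 0) (he : 0 < e * (4 * α * γ - β ^ 2)) (hc : HasCubicLeadingTerm g
      fun p => α * p.1 ^ 2 * p.2 + β * p.1 * p.2 ^ 2 + γ * p.2 ^ 3) :
    ∃ (X Y : ℝ × ℝ → ℝ) (X' Y' : ℝ × ℝ →L[ℝ] ℝ), ContDiff ℝ ∞ X ∧ ContDiff ℝ ∞ Y ∧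
      X 0 = 0 ∧ Y 0 = 0 ∧ HasFDerivAt X X' 0 ∧ HasFDerivAt Y Y' 0 ∧
      (∀ v, X' v = 0 → Y' v = 0 → v = 0) ∧
      ∀ᶠ p in 𝓝 0, g p = g 0 + X p ^ 2 * Y p + e * Y p ^ 3 := by
  obtain ⟨u, q, hu, hu0, hq, hq0, hq1, hq2, hgq⟩ := hc.exists_factorization hg hα
  have hq2' : ∀ p l, fderiv ℝ (fderiv ℝ q) 0 p (0, l) = (β * p.1 + 2 * α * p.2) * l := by
    intro p l
    have a0 := hq2 (1, 0)
    have a1 := hq2 (0, 1)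
    have a2 := hq2 (1, 1)
    have hs := hq.fderiv_fderiv_comm 0 ((0 : ℝ), (1 : ℝ)) ((1 : ℝ), (0 : ℝ))
    rw [ContinuousLinearMap.apply_apply_real_prod] at a2 ⊢
    rw [hs] at a2
    simp only at a0 a1 a2
    have b1 : fderiv ℝ (fderiv ℝ q) 0 (1, 0) (0, 1) = β := by linarith
    rw [b1, a1]
    ring
  -- split off the square in `x`, with `η` as a parameter
  have h2α : 2 * α ≠ 0 := mul_ne_zero two_ne_zero hα
  let H : ℝ ≃L[ℝ] (ℝ →L[ℝ] ℝ) :=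
    (mulEquiv (2 * α) h2α).trans (ContinuousLinearMap.toSpanSingletonCLE (𝕜 := ℝ) (E := ℝ))
  have hH : ∀ k l, H k l = 2 * α * k * l := fun k l => by
    simp [H, mulEquiv_apply]; ring
  obtain ⟨ψ, w, w', hψ, hψ0, hw, hw0, hwd, hw', hqw⟩ := exists_splitting hq (by simp [hq1]) H
    (fun k l => by rw [hq2', hH]; simp)
  have hw'' : ∀ p, 2 * α * w' p = β * p.1 + 2 * α * p.2 := fun p => by
    have := hw' p 1
    rwa [hH, hq2', mul_one, mul_one] at this
  let r : ℝ → ℝ := fun y => q (y, ψ y)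
  have hr : ContDiff ℝ ∞ r := hq.comp (contDiff_id.prodMk hψ)
  have hr0 : r 0 = 0 := by
    simp only [r, hψ0]
    exact hq0
  have hrlim : Tendsto (fun t : ℝ => r t / t ^ 2) (𝓝[≠] 0) (𝓝 (γ - β ^ 2 / (4 * α))) := by
    have l1 := tendsto_sub_div_sq hq ((1 : ℝ), (0 : ℝ)) (by simp [hq1])
    rw [hq2, hq0] at l1
    have l2 : Tendsto (fun t : ℝ => w (t • ((1 : ℝ), (0 : ℝ))) / t) (𝓝[≠] 0) (𝓝 (w' (1, 0))) := by
      have hline : HasDerivAt (fun t : ℝ => t • ((1 : ℝ), (0 : ℝ))) (1, 0) 0 := by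
        simpa using (hasDerivAt_id (0 : ℝ)).smul_const ((1 : ℝ), (0 : ℝ))
      have hwd' : HasFDerivAt w w' ((0 : ℝ) • ((1 : ℝ), (0 : ℝ))) := by rwa [zero_smul]
      have := (hwd'.comp_hasDerivAt 0 hline).tendsto_slope_zero
      refine this.congr fun t => ?_
      have hw00 : w (0, 0) = 0 := hw0
      simp [hw00, div_eq_inv_mul]
    have l3 := l1.sub ((l2.pow 2).const_mul α)
    have hw1 : w' (1, 0) = β / (2 * α) := by
      have := hw'' (1, 0)
      field_simp
      linarith
    have h4 : 2⁻¹ * (2 * (α * (0 : ℝ) ^ 2 + β * 0 * 1 + γ * 1 ^ 2)) - α * w' (1, 0) ^ 2 =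
        γ - β ^ 2 / (4 * α) := by
      rw [hw1]; field_simp; ring
    rw [h4] at l3
    refine l3.congr' ?_
    filter_upwards [self_mem_nhdsWithin, (tendsto_smul_punctured ((1 : ℝ), (0 : ℝ))).eventually hqw]
      with t ht h5
    have ht : t ≠ 0 := ht
    rw [h5, hH]
    simp [r]
    field_simp
    ring
  -- the remaining function of `η` vanishes to second order
  obtain ⟨r₁, hr₁, hrr₁⟩ := hr.exists_hadamard_zero
  obtain ⟨r₂, hr₂, hrr₂⟩ := hr₁.exists_hadamard_zero
  have hr₁0 : r₁ 0 = 0 := by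
    ext
    have l1 := hrlim.mul tendsto_id_punctured
    rw [mul_zero] at l1
    have l2 : Tendsto (fun t => r₁ t 1) (𝓝[≠] 0) (𝓝 (r₁ 0 1)) :=
      ((hr₁.continuous.clm_apply continuous_const).tendsto 0).comp tendsto_id_punctured
    refine tendsto_nhds_unique (l2.congr' ?_) l1
    filter_upwards [self_mem_nhdsWithin] with t ht
    have ht : t ≠ 0 := ht
    rw [hrr₁ t, hr0, (r₁ t).apply_real t]
    field_simp
    ring
  let s : ℝ → ℝ := fun y => r₂ y 1 1
  have hs : ContDiff ℝ ∞ s := (hr₂.clm_apply contDiff_const).clm_apply contDiff_const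
  have hrs : ∀ y, r y = y ^ 2 * s y := fun y => by
    rw [hrr₁, hrr₂, hr0, hr₁0, zero_add, zero_add, ContinuousLinearMap.apply_real]
    have : r₂ y y = y • r₂ y 1 := by rw [← map_smul, smul_eq_mul, mul_one]
    rw [this]
    simp [s]
    ring
  have hs0 : s 0 = γ - β ^ 2 / (4 * α) := by
    have l2 : Tendsto s (𝓝[≠] 0) (𝓝 (s 0)) := (hs.continuous.tendsto 0).comp tendsto_id_punctured
    refine tendsto_nhds_unique (l2.congr' ?_) hrlim
    filter_upwards [self_mem_nhdsWithin] with t ht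
    have ht : t ≠ 0 := ht
    rw [hrs t]
    field_simp
  obtain ⟨a, b, ha, hb, hab⟩ := exists_rescaling (α := α) (e := e) hs (by
    rw [hs0]
    have : e * α * (γ - β ^ 2 / (4 * α)) = e * (4 * α * γ - β ^ 2) / 4 := by field_simp
    rw [this]; positivity)
  -- `α = b² a` near `0` shows that both factors are units
  have hab0 := hab.self_of_nhds.1
  have ha0 : a 0 ≠ 0 := fun h => hα (by rw [← hab0, h, mul_zero])
  have hb0 : b 0 ≠ 0 := fun h => hα (by rw [← hab0, h]; simp)
  let η : ℝ × ℝ → ℝ := fun p => p.2 - p.1 * u p.1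
  have hη : ContDiff ℝ ∞ η := by fun_prop
  have hη0 : η 0 = 0 := by simp [η]
  have hηd : HasFDerivAt η (ContinuousLinearMap.snd ℝ ℝ ℝ) 0 := by
    have hud : HasFDerivAt (fun p : ℝ × ℝ => u p.1) (fderiv ℝ (fun p : ℝ × ℝ => u p.1) 0) 0 :=
      ((hu.comp contDiff_fst).differentiable (by simp) 0).hasFDerivAt
    have := (hasFDerivAt_snd (𝕜 := ℝ) (p := (0 : ℝ × ℝ))).sub
      ((hasFDerivAt_fst (𝕜 := ℝ) (p := (0 : ℝ × ℝ))).mul hud)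
    refine this.congr_fderiv ?_
    simp [hu0]
  let σ : ℝ × ℝ → ℝ × ℝ := fun p => (η p, p.1)
  have hσ : ContDiff ℝ ∞ σ := hη.prodMk contDiff_fst
  have hσ0 : σ 0 = 0 := by simp [σ, hη0]
  have hσd : HasFDerivAt σ
      ((ContinuousLinearMap.snd ℝ ℝ ℝ).prod (ContinuousLinearMap.fst ℝ ℝ ℝ)) 0 :=
    hηd.prodMk hasFDerivAt_fst
  have hwσ : HasFDerivAt (fun p => w (σ p))
      (w'.comp ((ContinuousLinearMap.snd ℝ ℝ ℝ).prod (ContinuousLinearMap.fst ℝ ℝ ℝ))) 0 := by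
    have : HasFDerivAt w w' (σ 0) := by rwa [hσ0]
    exact this.comp 0 hσd
  have hbη : HasFDerivAt (fun p => b (η p)) (fderiv ℝ (fun p => b (η p)) 0) 0 :=
    ((hb.comp hη).differentiable (by simp) 0).hasFDerivAt
  have haη : HasFDerivAt (fun p => a (η p)) (fderiv ℝ (fun p => a (η p)) 0) 0 :=
    ((ha.comp hη).differentiable (by simp) 0).hasFDerivAt
  refine ⟨fun p => w (σ p) * b (η p), fun p => η p * a (η p), _, _,
    (hw.comp hσ).mul (hb.comp hη), hη.mul (ha.comp hη), by simp [hσ0, hw0], by simp [hη0],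
    hwσ.mul hbη, hηd.mul haη, ?_, ?_⟩
  · rintro ⟨x, y⟩ hX hY
    have hy : y = 0 := by simpa [hη0, ha0] using hY
    subst hy
    have hx : w' (0, x) = 0 := by simpa [hη0, hσ0, hw0, hb0] using hX
    have := hw'' (0, x)
    rw [hx] at this
    have : x = 0 := by simpa [hα] using this.symm
    rw [this]; rfl
  · have hηt : Tendsto η (𝓝 0) (𝓝 0) := hη.continuous.tendsto' _ _ hη0
    have hσt : Tendsto σ (𝓝 0) (𝓝 0) := hσ.continuous.tendsto' _ _ hσ0
    filter_upwards [hgq, hσt.eventually hqw, hηt.eventually hab] with p h1 h2 h3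
    have h4 : g p = g 0 + η p * q (σ p) := h1
    have h5 : q ((σ p).1, ψ (σ p).1) = r (η p) := rfl
    rw [h4, h2, hH, h5, hrs, ← h3.2]
    nth_rewrite 1 [← h3.1]
    ring

end Planar

/-! ### Binary cubic forms -/

section Discriminant

/-- The discriminant of a binary cubic form is multiplied by the sixth power of the determinant
under a linear substitution. -/
theorem cubicDiscr_of_substitution {A B C D a b c d p q r s : ℝ}
    (h : ∀ x y : ℝ, A * x ^ 3 + B * x ^ 2 * y + C * x * y ^ 2 + D * y ^ 3 =
      a * (p * x + q * y) ^ 3 + b * (p * x + q * y) ^ 2 * (r * x + s * y) +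
        c * (p * x + q * y) * (r * x + s * y) ^ 2 + d * (r * x + s * y) ^ 3) :
    cubicDiscr A B C D = (p * s - q * r) ^ 6 * cubicDiscr a b c d := by
  have h10 := h 1 0
  have h01 := h 0 1
  have h11 := h 1 1
  have h12 := h 1 (-1)
  have hA : A = a * p ^ 3 + b * p ^ 2 * r + c * p * r ^ 2 + d * r ^ 3 := by linarith
  have hD : D = a * q ^ 3 + b * q ^ 2 * s + c * q * s ^ 2 + d * s ^ 3 := by linarith
  have hB : B = 3 * a * p ^ 2 * q + b * (p ^ 2 * s + 2 * p * q * r) +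
      c * (q * r ^ 2 + 2 * p * r * s) + 3 * d * r ^ 2 * s := by
    subst hA hD; linarith
  have hC : C = 3 * a * p * q ^ 2 + b * (q ^ 2 * r + 2 * p * q * s) +
      c * (p * s ^ 2 + 2 * q * r * s) + 3 * d * r * s ^ 2 := by
    subst hA hD; linarith
  rw [hA, hB, hC, hD]
  unfold cubicDiscr
  ring

theorem exists_real_root_cubic (b c d : ℝ) : ∃ x : ℝ, x ^ 3 + b * x ^ 2 + c * x + d = 0 := by
  -- the sign of the cubic is that of its leading term at `± R`
  let R := 1 + |b| + |c| + |d|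
  have hb := abs_nonneg b
  have hc := abs_nonneg c
  have hd := abs_nonneg d
  have hR : 1 ≤ R := by simp only [R]; linarith
  have hR2 : R ≤ R ^ 2 := by nlinarith
  have key : |b| * R ^ 2 + |c| * R + |d| ≤ R ^ 3 := by
    have h1 : |c| * R ≤ |c| * R ^ 2 := mul_le_mul_of_nonneg_left hR2 hc
    have h2 : |d| * 1 ≤ |d| * R ^ 2 := mul_le_mul_of_nonneg_left (hR.trans hR2) hd
    have h3 : R ^ 3 = (1 + |b| + |c| + |d|) * R ^ 2 := by simp only [R]; ring
    nlinarith
  have hR0 : 0 ≤ R := by linarith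
  have b1 := mul_le_mul_of_nonneg_right (neg_abs_le b) (sq_nonneg R)
  have b2 := mul_le_mul_of_nonneg_right (le_abs_self b) (sq_nonneg R)
  have c1 := mul_le_mul_of_nonneg_right (neg_abs_le c) hR0
  have d1 := neg_abs_le d
  have d2 := le_abs_self d
  have hcont : Continuous fun x : ℝ => x ^ 3 + b * x ^ 2 + c * x + d := by fun_prop
  have := intermediate_value_Icc (by linarith : -R ≤ R) hcont.continuousOn
  obtain ⟨x, -, hx⟩ := this (show (0 : ℝ) ∈ _ from ⟨by nlinarith, by nlinarith⟩)
  exact ⟨x, hx⟩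

/-- After a linear change of variables a real binary cubic form is divisible by `y`. -/
theorem exists_substitution_divisible (A B C D : ℝ) :
    ∃ p q r s α β γ : ℝ, p * s - q * r ≠ 0 ∧ ∀ x y : ℝ,
      A * (p * x + q * y) ^ 3 + B * (p * x + q * y) ^ 2 * (r * x + s * y) +
        C * (p * x + q * y) * (r * x + s * y) ^ 2 + D * (r * x + s * y) ^ 3 =
      α * x ^ 2 * y + β * x * y ^ 2 + γ * y ^ 3 := by
  by_cases hA : A = 0
  · exact ⟨1, 0, 0, 1, B, C, D, by norm_num, fun x y => by rw [hA]; ring⟩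
  · obtain ⟨z, hz⟩ := exists_real_root_cubic (B / A) (C / A) (D / A)
    have hz' : A * z ^ 3 + B * z ^ 2 + C * z + D = 0 := by
      have : A * z ^ 3 + B * z ^ 2 + C * z + D =
          A * (z ^ 3 + B / A * z ^ 2 + C / A * z + D / A) := by field_simp
      rw [this, hz, mul_zero]
    refine ⟨z, 1, 1, 0, 3 * A * z ^ 2 + 2 * B * z + C, 3 * A * z + B, A, by norm_num,
      fun x y => ?_⟩
    linear_combination x ^ 3 * hz'

end Discriminant

/-! ### The third differential -/

section ThirdDifferential

variable {E : Type} [NormedAddCommGroup E] [NormedSpace ℝ E]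

set_option maxSynthPendingDepth 3

theorem iteratedFDeriv_three_apply (f : E → ℝ) (z : E) (m : Fin 3 → E) :
    iteratedFDeriv ℝ 3 f z m = fderiv ℝ (fderiv ℝ (fderiv ℝ f)) z (m 0) (m 1) (m 2) := by
  simp [iteratedFDeriv_succ_apply_right, Fin.init]

theorem ContDiff.third_fderiv_comm_left {f : E → ℝ} (hf : ContDiff ℝ ∞ f) (x u v w : E) :
    fderiv ℝ (fderiv ℝ (fderiv ℝ f)) x u v w = fderiv ℝ (fderiv ℝ (fderiv ℝ f)) x v u w := by
  have hf' := (contDiff_infty_iff_fderiv.1 hf).2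
  rw [(hf'.contDiffAt.isSymmSndFDerivAt
    (by simpa using (WithTop.coe_le_coe.2 le_top : ((2 : ℕ∞) : WithTop ℕ∞) ≤ ∞))).eq u v]

theorem ContDiff.third_fderiv_comm_right {f : E → ℝ} (hf : ContDiff ℝ ∞ f) (x u v w : E) :
    fderiv ℝ (fderiv ℝ (fderiv ℝ f)) x u v w = fderiv ℝ (fderiv ℝ (fderiv ℝ f)) x u w v := by
  have hf' := (contDiff_infty_iff_fderiv.1 hf).2
  have hf'' := (contDiff_infty_iff_fderiv.1 hf').2
  have hd : ∀ v w, HasFDerivAt (fun y => fderiv ℝ (fderiv ℝ f) y v w)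
      (((fderiv ℝ (fderiv ℝ (fderiv ℝ f)) x).flip v).flip w) x := by
    intro v w
    have h := (((hf''.differentiable (by simp) x).hasFDerivAt.clm_apply
      (hasFDerivAt_const v x)).clm_apply (hasFDerivAt_const w x))
    refine h.congr_fderiv ?_
    ext u
    simp
  have h1 := hd v w
  simp only [hf.fderiv_fderiv_comm _ v w] at h1
  simpa using congrArg (fun L : E →L[ℝ] ℝ => L u) (h1.unique (hd w v))

/-- The third differential at the origin on the plane of the first two coordinates. -/
theorem ContDiff.third_differential_on_plane {n : ℕ} {f : (Fin (n + 2) → ℝ) → ℝ}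
    (hf : ContDiff ℝ ∞ f) (x y : ℝ) :
    6⁻¹ * iteratedFDeriv ℝ 3 f 0 (fun _ => x • stdVec 0 + y • stdVec 1) =
      1 / 6 * thirdPartial f 0 0 0 * x ^ 3 + 1 / 2 * thirdPartial f 0 0 1 * x ^ 2 * y +
        1 / 2 * thirdPartial f 0 1 1 * x * y ^ 2 + 1 / 6 * thirdPartial f 1 1 1 * y ^ 3 := by
  simp only [thirdPartial, iteratedFDeriv_three_apply, map_add, map_smul, _root_.add_apply,
    _root_.smul_apply, smul_eq_mul]
  simp only [Matrix.cons_val]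
  rw [hf.third_fderiv_comm_right 0 (stdVec 0) (stdVec 1) (stdVec 0),
    hf.third_fderiv_comm_left 0 (stdVec 1) (stdVec 0) (stdVec 0),
    hf.third_fderiv_comm_right 0 (stdVec 0) (stdVec 1) (stdVec 0),
    hf.third_fderiv_comm_right 0 (stdVec 1) (stdVec 1) (stdVec 0),
    hf.third_fderiv_comm_left 0 (stdVec 1) (stdVec 0) (stdVec 1)]
  ring

end ThirdDifferential

/-! ### Second order behaviour along lines -/

section SecondOrder

open Filter Topology Set

variable {E F : Type} [NormedAddCommGroup E] [NormedSpace ℝ E] [FiniteDimensional ℝ E]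
  [NormedAddCommGroup F] [NormedSpace ℝ F]

omit [FiniteDimensional ℝ E] in
theorem tendsto_inv_smul_of_hasFDerivAt {h : E → F} {h' : E →L[ℝ] F} (hh : HasFDerivAt h h' 0)
    (h0 : h 0 = 0) (v : E) :
    Tendsto (fun t : ℝ => t⁻¹ • h (t • v)) (𝓝[≠] 0) (𝓝 (h' v)) := by
  have hline : HasDerivAt (fun t : ℝ => t • v) v 0 := by
    simpa using (hasDerivAt_id (0 : ℝ)).smul_const v
  have hh' : HasFDerivAt h h' ((0 : ℝ) • v) := by rwa [zero_smul]
  refine (hh'.comp_hasDerivAt 0 hline).tendsto_slope_zero.congr fun t => ?_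
  simp [h0]

/-- A smooth map whose first derivative vanishes in the direction `v` is `O(t²)` along `t v`. -/
theorem exists_tendsto_sq_inv_smul [CompleteSpace F] {h : E → F} (hh : ContDiff ℝ ∞ h) (h0 : h 0 = 0) {v : E}
    (hv : fderiv ℝ h 0 v = 0) :
    ∃ c, Tendsto (fun t : ℝ => (t ^ 2)⁻¹ • h (t • v)) (𝓝[≠] 0) (𝓝 c) := by
  obtain ⟨N, hN, hhN⟩ := hh.exists_hadamard_zero
  obtain ⟨M, hM, hNM⟩ := hN.exists_hadamard_zero
  have hN0 : N 0 v = 0 := by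
    rw [← hv]
    have l1 := tendsto_inv_smul_of_hasFDerivAt (hh.differentiable (by simp) 0).hasFDerivAt h0 v
    have l2 : Tendsto (fun t : ℝ => N (t • v) v) (𝓝[≠] 0) (𝓝 (N 0 v)) :=
      ((hN.continuous.clm_apply continuous_const).tendsto 0).comp (tendsto_smul_punctured v)
    refine tendsto_nhds_unique (l2.congr' ?_) l1
    filter_upwards [self_mem_nhdsWithin] with t ht
    rw [hhN (t • v), h0, zero_add, map_smul, inv_smul_smul₀ ht]
  have l2 : Tendsto (fun t : ℝ => M (t • v) v v) (𝓝[≠] 0) (𝓝 (M 0 v v)) :=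
    (((hM.continuous.clm_apply continuous_const).clm_apply continuous_const).tendsto 0).comp
      (tendsto_smul_punctured v)
  refine ⟨_, l2.congr' ?_⟩
  filter_upwards [self_mem_nhdsWithin] with t ht
  have ht : t ≠ 0 := ht
  have : h (t • v) = t ^ 2 • M (t • v) v v := by
    rw [hhN (t • v), h0, zero_add, map_smul, hNM (t • v), _root_.add_apply, hN0, zero_add,
      map_smul, _root_.smul_apply, smul_smul, sq]
  rw [this, inv_smul_smul₀ (pow_ne_zero 2 ht)]

theorem QuadraticForm.continuous_of_finiteDimensional (Q : QuadraticForm ℝ E) :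
    Continuous Q := by
  let B : E →ₗ[ℝ] E →L[ℝ] ℝ :=
    (LinearMap.toContinuousLinearMap : (E →ₗ[ℝ] ℝ) ≃ₗ[ℝ] (E →L[ℝ] ℝ)).toLinearMap ∘ₗ
      QuadraticMap.associated Q
  have hB : Continuous B := B.continuous_of_finiteDimensional
  have : (Q : E → ℝ) = fun x => B x x := by
    ext x
    exact (QuadraticMap.associated_eq_self_apply ℝ Q x).symm
  rw [this]
  exact hB.clm_apply continuous_id

end SecondOrder

/-! ### Invariance of the cubic form on the kernel of the Hessian -/

section Necessity

open Filter Topology Set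

variable {E F : Type} [NormedAddCommGroup E] [NormedSpace ℝ E] [FiniteDimensional ℝ E]
  [NormedAddCommGroup F] [NormedSpace ℝ F] [FiniteDimensional ℝ F]

/-- A change of variables agrees near the origin with a globally smooth map whose derivative at
the origin is bijective. -/
theorem IsChangeOfVariables.exists_contDiff {φ : OpenPartialHomeomorph E F}
    (hφ : IsChangeOfVariables φ) :
    ∃ h : E → F, ContDiff ℝ ∞ h ∧ h 0 = 0 ∧ (∀ᶠ x in 𝓝 0, x ∈ φ.source ∧ φ x = h x) ∧
      Function.Bijective (fderiv ℝ h 0) := by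
  obtain ⟨h0, h1, h2, h3⟩ := hφ
  have ht0 : (0 : F) ∈ φ.target := h1 ▸ φ.map_source h0
  have hs := φ.open_source.mem_nhds h0
  have ht := φ.open_target.mem_nhds ht0
  obtain ⟨h, hh, hhφ⟩ := h2.exists_contDiff_eventuallyEq hs
  obtain ⟨k, hk, hkφ⟩ := h3.exists_contDiff_eventuallyEq ht
  have hh0 : h 0 = 0 := by rw [hhφ.eq_of_nhds, h1]
  have hk0 : k 0 = 0 := by
    rw [hkφ.eq_of_nhds]; conv_lhs => rw [← h1]
    exact φ.left_inv h0
  have hht : Tendsto h (𝓝 0) (𝓝 0) := hh.continuous.tendsto' _ _ hh0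
  have hkt : Tendsto k (𝓝 0) (𝓝 0) := hk.continuous.tendsto' _ _ hk0
  have dh := (hh.differentiable (by simp) 0).hasFDerivAt
  have dk := (hk.differentiable (by simp) 0).hasFDerivAt
  have e1 : (fderiv ℝ k 0).comp (fderiv ℝ h 0) = ContinuousLinearMap.id ℝ E := by
    have dk' : HasFDerivAt k (fderiv ℝ k 0) (h 0) := by rwa [hh0]
    refine (dk'.comp 0 dh).unique ((hasFDerivAt_id 0).congr_of_eventuallyEq ?_)
    filter_upwards [hhφ, hht.eventually hkφ, hs] with x hx hx2 hx3
    change k (h x) = x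
    rw [hx2, hx, φ.left_inv hx3]
  have e2 : (fderiv ℝ h 0).comp (fderiv ℝ k 0) = ContinuousLinearMap.id ℝ F := by
    have dh' : HasFDerivAt h (fderiv ℝ h 0) (k 0) := by rwa [hk0]
    refine (dh'.comp 0 dk).unique ((hasFDerivAt_id 0).congr_of_eventuallyEq ?_)
    filter_upwards [hkφ, hkt.eventually hhφ, ht] with x hx hx2 hx3
    change h (k x) = x
    rw [hx2, hx, φ.right_inv hx3]
  refine ⟨h, hh, hh0, ?_, ?_⟩
  · filter_upwards [hs, hhφ] with x hx hx2 using ⟨hx, hx2.symm⟩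
  · exact Function.bijective_iff_has_inverse.2 ⟨fderiv ℝ k 0,
      fun x => congrArg (fun L : E →L[ℝ] E => L x) e1,
      fun x => congrArg (fun L : F →L[ℝ] F => L x) e2⟩

/-- Invariance of the cubic form on the kernel of the Hessian: a change of variables between
`f + Q₁` and `g + Q₂`, where `g` has cubic leading term `c`, induces an injective linear map from
the kernel of the Hessian of `f`, and it carries `c` to the third differential of `f`. -/
theorem RPlusEquivalent.exists_kernel_map {p q : ℕ} {f : E → ℝ} {g c : F → ℝ}
    (hf : ContDiff ℝ ∞ f) (hcrit : fderiv ℝ f 0 = 0) (hg : ContDiff ℝ ∞ g)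
    (hc : HasCubicLeadingTerm g c) {Q₁ : QuadraticForm ℝ (Fin p → ℝ)}
    {Q₂ : QuadraticForm ℝ (Fin q → ℝ)} (hQ₂ : Q₂.polarBilin.Nondegenerate)
    (h : RPlusEquivalent (fun x : E × (Fin p → ℝ) => f x.1 + Q₁ x.2)
      (fun y : F × (Fin q → ℝ) => g y.1 + Q₂ y.2)) :
    ∃ L : E →L[ℝ] F, ∀ v, fderiv ℝ (fderiv ℝ f) 0 v = 0 → (L v = 0 → v = 0) ∧
      6⁻¹ * iteratedFDeriv ℝ 3 f 0 (fun _ => v) = c (L v) := by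
  obtain ⟨φ, d, hφ, hfφ⟩ := h
  obtain ⟨k, hk, hk0, hkφ, hbij⟩ := hφ.exists_contDiff
  have heq : ∀ᶠ x : E × (Fin p → ℝ) in 𝓝 0, f x.1 + Q₁ x.2 = d + (g (k x).1 + Q₂ (k x).2) := by
    filter_upwards [hkφ] with x hx
    rw [← hx.2]
    exact hfφ x hx.1
  have hfd : f 0 = d + g 0 := by simpa [hk0] using heq.self_of_nhds
  have hQc := QuadraticForm.continuous_of_finiteDimensional Q₂
  let L := fderiv ℝ k 0
  have hL : HasFDerivAt k L 0 := (hk.differentiable (by simp) 0).hasFDerivAt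
  have hkv : ∀ v, Tendsto (fun t : ℝ => t⁻¹ • k (t • v)) (𝓝[≠] 0) (𝓝 (L v)) :=
    tendsto_inv_smul_of_hasFDerivAt hL hk0
  have hgv : ∀ v, Tendsto (fun t : ℝ => (g (k (t • v)).1 - g 0) / t ^ 3) (𝓝[≠] 0)
      (𝓝 (c (L v).1)) := fun v =>
    hc.tendsto_curve hg ((continuous_fst.tendsto _).comp (hkv v))
  have heqt : ∀ v : E × (Fin p → ℝ), ∀ᶠ t : ℝ in 𝓝[≠] 0, t ≠ 0 ∧
      f (t • v.1) - f 0 + t ^ 2 * Q₁ v.2 =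
        g (k (t • v)).1 - g 0 + Q₂ (k (t • v)).2 := by
    intro v
    filter_upwards [(tendsto_smul_punctured v).eventually heq, self_mem_nhdsWithin] with t ht ht0
    refine ⟨ht0, ?_⟩
    simp only [Prod.smul_fst, Prod.smul_snd, QuadraticMap.map_smul, smul_eq_mul] at ht
    rw [hfd]
    linarith
  -- comparison of the terms of second order
  have h2 : ∀ v : E × (Fin p → ℝ),
      2⁻¹ * fderiv ℝ (fderiv ℝ f) 0 v.1 v.1 + Q₁ v.2 = Q₂ (L v).2 := by
    intro v
    have l1 := (tendsto_sub_div_sq hf v.1 (by simp [hcrit])).add_const (Q₁ v.2)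
    have l2 := ((hgv v).mul tendsto_id_punctured).add
      ((hQc.tendsto _).comp ((continuous_snd.tendsto _).comp (hkv v)))
    rw [mul_zero, zero_add] at l2
    refine tendsto_nhds_unique (l1.congr' ?_) l2
    filter_upwards [heqt v] with t ht
    obtain ⟨ht0, ht⟩ := ht
    have : Q₂ (t⁻¹ • k (t • v)).2 = (t ^ 2)⁻¹ * Q₂ (k (t • v)).2 := by
      rw [Prod.smul_snd, QuadraticMap.map_smul, smul_eq_mul]
      field_simp
    simp only [Function.comp_apply, this]
    field_simp
    linarith
  -- the kernel of the Hessian is mapped to the kernel of the Hessian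
  have hker : ∀ v : E, fderiv ℝ (fderiv ℝ f) 0 v = 0 → (L (v, 0)).2 = 0 := by
    intro v hv
    -- by polarization, `(L (v, 0)).2` is orthogonal to the second component of every vector
    refine hQ₂.1 _ fun y => ?_
    obtain ⟨⟨a, b⟩, hab⟩ := hbij.2 ((0 : F), y)
    have hab : L (a, b) = (0, y) := hab
    have e1 := h2 (v, 0)
    have e2 := h2 (a, b)
    have e3 := h2 (v + a, b)
    have hva : L (v + a, b) = L (v, 0) + L (a, b) := by rw [← map_add]; simp
    rw [hva, Prod.snd_add] at e3
    have hs : fderiv ℝ (fderiv ℝ f) 0 a v = 0 := by rw [hf.fderiv_fderiv_comm, hv]; rfl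
    simp only [map_add, hv, hs, hab, _root_.zero_apply, QuadraticMap.map_zero,
      mul_zero, zero_add] at e1 e2 e3
    rw [QuadraticMap.polarBilin_apply_apply, QuadraticMap.polar, ← e1, ← e2, ← e3]
    ring
  refine ⟨(ContinuousLinearMap.fst ℝ F _).comp (L.comp (ContinuousLinearMap.inl ℝ E _)),
    fun v hv => ⟨fun h0 => ?_, ?_⟩⟩
  · have : L (v, 0) = L 0 := by
      rw [map_zero]
      exact Prod.ext h0 (hker v hv)
    exact congrArg Prod.fst (hbij.1 this)
  · -- comparison of the terms of third order, along a vector of the kernel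
    have hdk : fderiv ℝ (fun x => (k x).2) 0 (v, 0) = 0 := by
      have : HasFDerivAt (fun x => (k x).2) ((ContinuousLinearMap.snd ℝ F _).comp L) 0 := hL.snd
      rw [this.fderiv]
      exact hker v hv
    obtain ⟨b, hb⟩ := exists_tendsto_sq_inv_smul (h := fun x => (k x).2) (contDiff_snd.comp hk)
      (by simp [hk0]) hdk
    have l1 := tendsto_sub_div_cube hf v (by simp [hcrit]) (by simp [hv])
    have l2 := (hgv (v, 0)).add (((hQc.tendsto _).comp hb).mul tendsto_id_punctured)
    rw [mul_zero, add_zero] at l2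
    refine tendsto_nhds_unique (l1.congr' ?_) l2
    filter_upwards [heqt (v, 0)] with t ht
    obtain ⟨ht0, ht⟩ := ht
    simp only [QuadraticMap.map_zero, mul_zero, add_zero] at ht
    simp only [Function.comp_apply, QuadraticMap.map_smul, smul_eq_mul, ht]
    field_simp

theorem hessian_apply_plane_eq_zero {n : ℕ} {f : (Fin (n + 2) → ℝ) → ℝ}
    (hker : secondDifferentialKer f = Submodule.span ℝ {stdVec 0, stdVec 1}) (x y : ℝ) :
    fderiv ℝ (fderiv ℝ f) 0 (x • stdVec 0 + y • stdVec 1) = 0 := by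
  have : x • stdVec 0 + y • stdVec 1 ∈ secondDifferentialKer f := by
    rw [hker]
    exact Submodule.mem_span_pair.2 ⟨x, y, rfl⟩
  exact this

/-- The discriminant of a germ that is stably equivalent to `x² y + ε y³` has the sign of `ε`. -/
theorem StablyRPlusEquivalent.exists_discr3_eq {n : ℕ} {f : (Fin (n + 2) → ℝ) → ℝ}
    (hf : ContDiff ℝ ∞ f) (hcrit : fderiv ℝ f 0 = 0)
    (hker : secondDifferentialKer f = Submodule.span ℝ {stdVec 0, stdVec 1}) {ε : ℝ}
    (h : StablyRPlusEquivalent f fun x : Fin 2 → ℝ => x 0 ^ 2 * x 1 + ε * x 1 ^ 3) :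
    ∃ δ : ℝ, δ ≠ 0 ∧ discr3 f = δ ^ 6 * (4 * ε) := by
  obtain ⟨p, q, Q₁, Q₂, -, hQ₂, h⟩ := h
  have hc : HasCubicLeadingTerm (fun x : Fin 2 → ℝ => x 0 ^ 2 * x 1 + ε * x 1 ^ 3)
      (fun x : Fin 2 → ℝ => x 0 ^ 2 * x 1 + ε * x 1 ^ 3) := by
    intro v
    refine tendsto_const_nhds.congr' ?_
    filter_upwards [self_mem_nhdsWithin] with t ht
    have ht : t ≠ 0 := ht
    simp
    field_simp
  obtain ⟨L, hL⟩ := h.exists_kernel_map hf hcrit (by fun_prop) hc hQ₂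
  have hLxy : ∀ (x y : ℝ) (i : Fin 2), L (x • stdVec 0 + y • stdVec 1) i =
      L (stdVec 0) i * x + L (stdVec 1) i * y := fun x y i => by
    simp [mul_comm]
  have hinj : ∀ x y : ℝ, L (stdVec 0) 0 * x + L (stdVec 1) 0 * y = 0 →
      L (stdVec 0) 1 * x + L (stdVec 1) 1 * y = 0 → x = 0 ∧ y = 0 := by
    intro x y h0 h1
    have := (hL _ (hessian_apply_plane_eq_zero hker x y)).1 (by
      ext i
      fin_cases i
      · exact (hLxy x y 0).trans h0
      · exact (hLxy x y 1).trans h1)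
    have e0 := congrFun this 0
    have e1 := congrFun this 1
    simp [stdVec] at e0 e1
    exact ⟨e0, e1⟩
  -- `δ` is the determinant of the induced map between the kernels
  refine ⟨L (stdVec 0) 0 * L (stdVec 1) 1 - L (stdVec 1) 0 * L (stdVec 0) 1, fun h0 => ?_, ?_⟩
  · have a := hinj (L (stdVec 1) 0) (-L (stdVec 0) 0) (by ring) (by linarith)
    have b := hinj (L (stdVec 1) 1) (-L (stdVec 0) 1) (by linarith) (by ring)
    have := hinj 1 0 (by linarith [a.2]) (by linarith [b.2])
    exact one_ne_zero this.1
  · have : (4 : ℝ) * ε = cubicDiscr 0 1 0 ε := by simp [cubicDiscr]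
    rw [this]
    refine cubicDiscr_of_substitution fun x y => ?_
    rw [← hf.third_differential_on_plane, (hL _ (hessian_apply_plane_eq_zero hker x y)).2, hLxy,
      hLxy]
    ring

end Necessity

/-! ### Normal form in all variables -/

section NormalForm

open Filter Topology Set

/-- An injective linear map between spaces of the same finite dimension, as a continuous linear
equivalence. -/
noncomputable def equivOfInjective {E F : Type} [NormedAddCommGroup E] [NormedSpace ℝ E]
    [FiniteDimensional ℝ E] [NormedAddCommGroup F] [NormedSpace ℝ F] [FiniteDimensional ℝ F]
    (L : E →L[ℝ] F) (hL : ∀ v, L v = 0 → v = 0)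
    (h : Module.finrank ℝ E = Module.finrank ℝ F) : E ≃L[ℝ] F :=
  (LinearMap.linearEquivOfInjective (L : E →ₗ[ℝ] F)
    ((injective_iff_map_eq_zero (L : E →ₗ[ℝ] F)).2 hL) h).toContinuousLinearEquiv

theorem equivOfInjective_apply {E F : Type} [NormedAddCommGroup E] [NormedSpace ℝ E]
    [FiniteDimensional ℝ E] [NormedAddCommGroup F] [NormedSpace ℝ F] [FiniteDimensional ℝ F]
    (L : E →L[ℝ] F) (hL : ∀ v, L v = 0 → v = 0)
    (h : Module.finrank ℝ E = Module.finrank ℝ F) (v : E) : equivOfInjective L hL h v = L v := rfl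

/-- Separation of the first two coordinates of `ℝ ^ (n + 2)` from the other ones. -/
noncomputable def consEquiv (n : ℕ) : ((ℝ × ℝ) × (Fin n → ℝ)) ≃L[ℝ] (Fin (n + 2) → ℝ) :=
  LinearEquiv.toContinuousLinearEquiv
    { toFun := fun p => Fin.cons p.1.1 (Fin.cons p.1.2 p.2 : Fin (n + 1) → ℝ)
      invFun := fun k => ((k 0, k 1), fun i => k i.succ.succ)
      map_add' := fun p q => by
        ext i
        refine Fin.cases ?_ (fun j => Fin.cases ?_ (fun l => ?_) j) i <;> simp
      map_smul' := fun c p => by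
        ext i
        refine Fin.cases ?_ (fun j => Fin.cases ?_ (fun l => ?_) j) i <;> simp
      left_inv := fun p => by
        ext
        · rfl
        · rfl
        · simp
      right_inv := fun k => by
        ext i
        refine Fin.cases ?_ (fun j => Fin.cases ?_ (fun l => ?_) j) i <;> simp }

theorem consEquiv_apply_zero {n : ℕ} (p : (ℝ × ℝ) × (Fin n → ℝ)) : consEquiv n p 0 = p.1.1 := rfl

theorem consEquiv_apply_one {n : ℕ} (p : (ℝ × ℝ) × (Fin n → ℝ)) : consEquiv n p 1 = p.1.2 := rfl

theorem consEquiv_apply_succ {n : ℕ} (p : (ℝ × ℝ) × (Fin n → ℝ)) (i : Fin n) :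
    consEquiv n p i.succ.succ = p.2 i := rfl

theorem consEquiv_plane {n : ℕ} (x y : ℝ) :
    consEquiv n ((x, y), 0) = x • stdVec 0 + y • stdVec 1 := by
  ext i
  refine Fin.cases ?_ (fun j => Fin.cases ?_ (fun l => ?_) j) i
  · rw [consEquiv_apply_zero]; simp [stdVec]
  · change consEquiv n ((x, y), 0) 1 = _
    rw [consEquiv_apply_one]; simp [stdVec]
  · rw [consEquiv_apply_succ]
    simp [stdVec, Fin.ext_iff]

/-- An invertible linear substitution in two variables. -/
theorem exists_substitution_equiv {p q r s : ℝ} (h : p * s - q * r ≠ 0) :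
    ∃ T : (ℝ × ℝ) ≃L[ℝ] (ℝ × ℝ), ∀ v, T v = (p * v.1 + q * v.2, r * v.1 + s * v.2) := by
  let x := ContinuousLinearMap.fst ℝ ℝ ℝ
  let y := ContinuousLinearMap.snd ℝ ℝ ℝ
  refine ⟨equivOfInjective ((p • x + q • y).prod (r • x + s • y)) ?_ rfl, fun v => by
    rw [equivOfInjective_apply]; simp [x, y]⟩
  rintro ⟨a, b⟩ hv
  have h1 : p * a + q * b = 0 := by simpa [x, y] using congrArg Prod.fst hv
  have h2 : r * a + s * b = 0 := by simpa [x, y] using congrArg Prod.snd hv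
  have ha : (p * s - q * r) * a = 0 := by linear_combination s * h1 - q * h2
  have hb : (p * s - q * r) * b = 0 := by linear_combination p * h2 - r * h1
  exact Prod.ext ((mul_eq_zero.1 ha).resolve_left h) ((mul_eq_zero.1 hb).resolve_left h)

/-- The quadratic form `z ↦ ½ H (z, z)` of a symmetric nondegenerate bilinear form. -/
theorem exists_nondegenerate_quadraticForm {F : Type} [NormedAddCommGroup F] [NormedSpace ℝ F]
    (H : F ≃L[ℝ] (F →L[ℝ] ℝ)) (hH : ∀ u v, H u v = H v u) :
    ∃ Q : QuadraticForm ℝ F, Q.polarBilin.Nondegenerate ∧ ∀ z, Q z = 2⁻¹ * H z z := by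
  let B : F →ₗ[ℝ] F →ₗ[ℝ] ℝ := LinearMap.mk₂ ℝ (fun u v => 2⁻¹ * H u v)
    (by intros; simp [mul_add]) (by intros; simp; ring) (by intros; simp [mul_add])
    (by intros; simp; ring)
  let Q : QuadraticForm ℝ F := LinearMap.BilinMap.toQuadraticMap B
  have hQ : ∀ z, Q z = 2⁻¹ * H z z := fun z => rfl
  have hp : ∀ u v, Q.polarBilin u v = H u v := by
    intro u v
    rw [QuadraticMap.polarBilin_apply_apply, QuadraticMap.polar, hQ, hQ, hQ]
    simp only [map_add, _root_.add_apply]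
    rw [hH v u]
    ring
  refine ⟨Q, ⟨fun u hu => ?_, fun u hu => ?_⟩, hQ⟩
  · refine H.map_eq_zero_iff.1 ?_
    ext v
    rw [← hp, hu]; rfl
  · refine H.map_eq_zero_iff.1 ?_
    ext v
    rw [hH, ← hp, hu]; rfl

/-- If the Hessian has the plane of the first two coordinates as its kernel, it is nondegenerate
on the space of the other coordinates. -/
theorem exists_partial_hessian_equiv {n : ℕ} {f : (Fin (n + 2) → ℝ) → ℝ} (hf : ContDiff ℝ ∞ f)
    (hker : secondDifferentialKer f = Submodule.span ℝ {stdVec 0, stdVec 1}) :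
    ∃ H : (Fin n → ℝ) ≃L[ℝ] ((Fin n → ℝ) →L[ℝ] ℝ), ∀ k l,
      H k l = fderiv ℝ (fderiv ℝ f) 0 (consEquiv n (0, k)) (consEquiv n (0, l)) := by
  let ι : (Fin n → ℝ) →L[ℝ] (Fin (n + 2) → ℝ) :=
    (consEquiv n : _ →L[ℝ] _).comp (ContinuousLinearMap.inr ℝ (ℝ × ℝ) (Fin n → ℝ))
  have hι : ∀ k, ι k = consEquiv n (0, k) := fun k => rfl
  refine ⟨equivOfInjective ((fderiv ℝ (fderiv ℝ f) 0).bilinearComp ι ι) (fun k hk => ?_) ?_,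
    fun k l => by rw [equivOfInjective_apply]; rfl⟩
  · have hmem : consEquiv n (0, k) ∈ secondDifferentialKer f := by
      change fderiv ℝ (fderiv ℝ f) 0 (consEquiv n (0, k)) = 0
      ext v
      obtain ⟨⟨⟨x, y⟩, l⟩, rfl⟩ := (consEquiv n).surjective v
      have hsum : (((x, y), l) : (ℝ × ℝ) × (Fin n → ℝ)) = ((x, y), 0) + (0, l) := by simp
      rw [hsum, map_add, map_add, hf.fderiv_fderiv_comm, consEquiv_plane,
        hessian_apply_plane_eq_zero hker]
      have : fderiv ℝ (fderiv ℝ f) 0 (consEquiv n (0, k)) (consEquiv n (0, l)) = 0 :=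
        congrArg (fun A : (Fin n → ℝ) →L[ℝ] ℝ => A l) hk
      rw [this]
      simp
    rw [hker] at hmem
    obtain ⟨x, y, hxy⟩ := Submodule.mem_span_pair.1 hmem
    rw [← consEquiv_plane] at hxy
    exact (congrArg Prod.snd ((consEquiv n).injective hxy)).symm
  · have e : ((Fin n → ℝ) →ₗ[ℝ] ℝ) ≃ₗ[ℝ] ((Fin n → ℝ) →L[ℝ] ℝ) := LinearMap.toContinuousLinearMap
    rw [← e.finrank_eq]
    exact (Subspace.dual_finrank_eq (K := ℝ) (V := Fin n → ℝ)).symm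

/-- The normal form `x² y + e y³ + Q z` near the origin, for every `e` of the sign of the
discriminant, in terms of a smooth map with invertible derivative at the origin. -/
theorem exists_normal_form {n : ℕ} {f : (Fin (n + 2) → ℝ) → ℝ} (hf : ContDiff ℝ ∞ f)
    (hcrit : fderiv ℝ f 0 = 0)
    (hker : secondDifferentialKer f = Submodule.span ℝ {stdVec 0, stdVec 1}) {e : ℝ}
    (he : 0 < e * discr3 f) :
    ∃ (Θ : (Fin (n + 2) → ℝ) → (ℝ × ℝ) × (Fin n → ℝ))
      (Θ' : (Fin (n + 2) → ℝ) ≃L[ℝ] (ℝ × ℝ) × (Fin n → ℝ)) (Q : QuadraticForm ℝ (Fin n → ℝ)),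
      ContDiff ℝ ∞ Θ ∧ Θ 0 = 0 ∧ HasFDerivAt Θ (Θ' : _ →L[ℝ] _) 0 ∧ Q.polarBilin.Nondegenerate ∧
      ∀ᶠ k in 𝓝 0, f k =
        f 0 + ((Θ k).1.1 ^ 2 * (Θ k).1.2 + e * (Θ k).1.2 ^ 3 + Q (Θ k).2) := by
  obtain ⟨H, hH⟩ := exists_partial_hessian_equiv hf hker
  have hHs : ∀ u v, H u v = H v u := fun u v => by rw [hH, hH, hf.fderiv_fderiv_comm]
  obtain ⟨Q, hQ, hQH⟩ := exists_nondegenerate_quadraticForm H hHs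
  -- choose the coordinates of the plane so that the cubic form vanishes on the line `y = 0`
  obtain ⟨p, q, r, s, α, β, γ, hdet, hcubic⟩ := exists_substitution_divisible
    (1 / 6 * thirdPartial f 0 0 0) (1 / 2 * thirdPartial f 0 0 1)
    (1 / 2 * thirdPartial f 0 1 1) (1 / 6 * thirdPartial f 1 1 1)
  obtain ⟨T, hT⟩ := exists_substitution_equiv hdet
  have hdiscr : cubicDiscr 0 α β γ = (p * s - q * r) ^ 6 * discr3 f :=
    cubicDiscr_of_substitution fun x y => by rw [hcubic]; ring
  have hpos : 0 < e * cubicDiscr 0 α β γ := by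
    rw [hdiscr, mul_left_comm]
    have : 0 < (p * s - q * r) ^ 6 := by positivity
    positivity
  have hαβγ : e * cubicDiscr 0 α β γ = α ^ 2 * (e * (4 * α * γ - β ^ 2)) := by
    unfold cubicDiscr; ring
  rw [hαβγ] at hpos
  have hα : α ≠ 0 := by rintro rfl; simp at hpos
  have he' : 0 < e * (4 * α * γ - β ^ 2) := pos_of_mul_pos_right hpos (sq_nonneg α)
  let Λ : ((ℝ × ℝ) × (Fin n → ℝ)) ≃L[ℝ] (Fin (n + 2) → ℝ) :=
    (T.prodCongr (ContinuousLinearEquiv.refl ℝ (Fin n → ℝ))).trans (consEquiv n)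
  have hΛz : ∀ z, Λ (0, z) = consEquiv n (0, z) := fun z => by simp [Λ]
  have hΛv : ∀ v : ℝ × ℝ, Λ (v, 0) =
      (p * v.1 + q * v.2) • stdVec 0 + (r * v.1 + s * v.2) • stdVec 1 := fun v => by
    rw [← consEquiv_plane, ← hT]; simp [Λ]
  have hΛker : ∀ v : ℝ × ℝ, fderiv ℝ (fderiv ℝ f) 0 (Λ (v, 0)) = 0 := fun v => by
    rw [hΛv, hessian_apply_plane_eq_zero hker]
  let F : (ℝ × ℝ) × (Fin n → ℝ) → ℝ := fun x => f (Λ x)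
  have hF : ContDiff ℝ ∞ F := hf.comp Λ.contDiff
  have hFd : ∀ x, fderiv ℝ F x = (fderiv ℝ f (Λ x)).comp (Λ : _ →L[ℝ] _) := fun x =>
    ((hf.differentiable (by simp) _).hasFDerivAt.comp x Λ.hasFDerivAt).fderiv
  have hFd2 : ∀ u v, fderiv ℝ (fderiv ℝ F) 0 u v = fderiv ℝ (fderiv ℝ f) 0 (Λ u) (Λ v) := by
    intro u v
    have hf' := (contDiff_infty_iff_fderiv.1 hf).2
    have h0 : HasFDerivAt (fderiv ℝ f) (fderiv ℝ (fderiv ℝ f) 0) (Λ 0) := by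
      rw [map_zero]; exact (hf'.differentiable (by simp) 0).hasFDerivAt
    have h1 := (h0.comp 0 Λ.hasFDerivAt).clm_comp
      (hasFDerivAt_const (Λ : ((ℝ × ℝ) × (Fin n → ℝ)) →L[ℝ] (Fin (n + 2) → ℝ)) 0)
    have h2 : fderiv ℝ F = fun x => (fderiv ℝ f (Λ x)).comp (Λ : _ →L[ℝ] _) := funext hFd
    rw [h2]
    have h3 := h1.fderiv
    simp only [Function.comp_def] at h3
    rw [h3]
    simp
  obtain ⟨ψ, w, w', hψ, hψ0, hw, hw0, hwd, hw', hFw⟩ := exists_splitting hF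
    (fun z => by rw [hFd, map_zero, hcrit]; simp) H
    (fun k l => by rw [hFd2, hΛz, hΛz, hH])
  have hw'z : ∀ z, w' (0, z) = z := fun z => by
    apply H.injective
    ext l
    rw [hw', hFd2, hΛz, hΛz, hH]
  have hw'v : ∀ v, w' (v, 0) = 0 := fun v => by
    apply H.injective
    ext l
    rw [hw', hFd2, hΛker]
    simp
  -- the function of two variables that is left after the splitting
  let g : ℝ × ℝ → ℝ := fun v => F (v, ψ v)
  have hg : ContDiff ℝ ∞ g := hF.comp (contDiff_id.prodMk hψ)
  have hg0 : g 0 = f 0 := by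
    simp only [g, F, hψ0]
    exact congrArg f (map_zero Λ)
  have hgc : HasCubicLeadingTerm g
      fun v => α * v.1 ^ 2 * v.2 + β * v.1 * v.2 ^ 2 + γ * v.2 ^ 3 := by
    intro v
    -- `f (t v) = g (t v) + ½ H (w, w)` with `w = O(t²)`, so the two functions agree to order three
    obtain ⟨c, hc⟩ := exists_tendsto_sq_inv_smul hw hw0 (v := (v, 0)) (by rw [hwd.fderiv, hw'v])
    have l1 := tendsto_sub_div_cube hf (Λ (v, 0)) (by simp [hcrit]) (by simp [hΛker])
    have hHc : Continuous fun z => 2⁻¹ * H z z :=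
      continuous_const.mul (H.continuous.clm_apply continuous_id)
    have l2 := l1.sub (((hHc.tendsto c).comp hc).mul tendsto_id_punctured)
    rw [mul_zero, sub_zero, hΛv, hf.third_differential_on_plane, hcubic] at l2
    refine l2.congr' ?_
    filter_upwards [self_mem_nhdsWithin,
      (tendsto_smul_punctured ((v, 0) : (ℝ × ℝ) × (Fin n → ℝ))).eventually hFw] with t ht h1
    have ht : t ≠ 0 := ht
    have h2 : F (t • (v, 0)) = f (t • Λ (v, 0)) := by simp only [F, map_smul]
    have h3 : F ((t • ((v, 0) : (ℝ × ℝ) × (Fin n → ℝ))).1,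
      ψ (t • ((v, 0) : (ℝ × ℝ) × (Fin n → ℝ))).1) = g (t • v) := rfl
    rw [h2, h3, hΛv] at h1
    simp only [Function.comp_apply, map_smul, _root_.smul_apply, smul_eq_mul, h1, hg0]
    field_simp
    ring
  obtain ⟨X, Y, X', Y', hX, hY, hX0, hY0, hXd, hYd, hXY, hgXY⟩ :=
    hgc.exists_planar_normal_form hg hα he'
  let Ψ : (ℝ × ℝ) × (Fin n → ℝ) → (ℝ × ℝ) × (Fin n → ℝ) := fun x => ((X x.1, Y x.1), w x)
  have hΨ : ContDiff ℝ ∞ Ψ := ((hX.comp contDiff_fst).prodMk (hY.comp contDiff_fst)).prodMk hw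
  let π := ContinuousLinearMap.fst ℝ (ℝ × ℝ) (Fin n → ℝ)
  have hΨd : HasFDerivAt Ψ (((X'.comp π).prod (Y'.comp π)).prod w') 0 := by
    have a1 : HasFDerivAt X X' (0 : (ℝ × ℝ) × (Fin n → ℝ)).1 := hXd
    have a2 : HasFDerivAt Y Y' (0 : (ℝ × ℝ) × (Fin n → ℝ)).1 := hYd
    exact ((a1.comp 0 hasFDerivAt_fst).prodMk (a2.comp 0 hasFDerivAt_fst)).prodMk hwd
  let Ψ' := equivOfInjective (((X'.comp π).prod (Y'.comp π)).prod w') (fun x hx => by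
    obtain ⟨v, z⟩ := x
    have h1 : X' v = 0 := congrArg (fun y => y.1.1) hx
    have h2 : Y' v = 0 := congrArg (fun y => y.1.2) hx
    have h3 : w' (v, z) = 0 := congrArg Prod.snd hx
    obtain rfl := hXY v h1 h2
    rw [hw'z] at h3
    rw [h3]; rfl) rfl
  refine ⟨fun k => Ψ (Λ.symm k), Λ.symm.trans Ψ', Q, hΨ.comp Λ.symm.contDiff, ?_, ?_, hQ, ?_⟩
  · simp only [map_zero, Ψ, Prod.fst_zero, hX0, hY0, hw0]
    rfl
  · have h0 : HasFDerivAt Ψ (Ψ' : _ →L[ℝ] _) (Λ.symm 0) := by rw [map_zero]; exact hΨd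
    exact h0.comp 0 Λ.symm.hasFDerivAt
  · have ht : Tendsto Λ.symm (𝓝 0) (𝓝 0) := Λ.symm.continuous.tendsto' _ _ (map_zero _)
    have ht1 : Tendsto (fun k => (Λ.symm k).1) (𝓝 0) (𝓝 0) := (continuous_fst.tendsto _).comp ht
    filter_upwards [ht.eventually hFw, ht1.eventually hgXY] with k h1 h2
    have h3 : F (Λ.symm k) = f k := by simp [F]
    have h4 : F ((Λ.symm k).1, ψ (Λ.symm k).1) = g (Λ.symm k).1 := rfl
    rw [h3, h4, h2, hg0] at h1
    rw [h1, hQH]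
    simp only [Ψ]
    ring

/-- The normal form as a stable equivalence with `x² y + e y³`. -/
theorem stablyRPlusEquivalent_of_discr3 {n : ℕ} {f : (Fin (n + 2) → ℝ) → ℝ}
    (hf : ContDiff ℝ ∞ f) (hcrit : fderiv ℝ f 0 = 0)
    (hker : secondDifferentialKer f = Submodule.span ℝ {stdVec 0, stdVec 1}) {e : ℝ}
    (he : 0 < e * discr3 f) :
    StablyRPlusEquivalent f fun x : Fin 2 → ℝ => x 0 ^ 2 * x 1 + e * x 1 ^ 3 := by
  obtain ⟨Θ, Θ', Q, hΘ, hΘ0, hΘd, hQ, hfΘ⟩ := exists_normal_form hf hcrit hker he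
  let τ : ((ℝ × ℝ) × (Fin n → ℝ)) ≃L[ℝ] (Fin 2 → ℝ) × (Fin n → ℝ) :=
    (ContinuousLinearEquiv.finTwoArrow ℝ ℝ).symm.prodCongr (ContinuousLinearEquiv.refl ℝ _)
  let κ : ((Fin (n + 2) → ℝ) × (Fin 0 → ℝ)) ≃L[ℝ] (Fin (n + 2) → ℝ) :=
    ContinuousLinearEquiv.prodUnique ℝ _ _
  have hd : HasFDerivAt (fun x => τ (Θ (κ x))) ((κ.trans (Θ'.trans τ) : _ ≃L[ℝ] _) : _ →L[ℝ] _)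
      0 := by
    have h0 : HasFDerivAt Θ (Θ' : _ →L[ℝ] _) (κ 0) := by rwa [map_zero]
    exact τ.hasFDerivAt.comp 0 (h0.comp 0 κ.hasFDerivAt)
  have hκ : Tendsto κ (𝓝 0) (𝓝 0) := κ.continuous.tendsto' _ _ (map_zero _)
  obtain ⟨φ, hφ, hφΘ⟩ := ContDiff.exists_isChangeOfVariables
    (τ.contDiff.comp (hΘ.comp κ.contDiff)) _ hd (by simp [hΘ0]) (hκ.eventually hfΘ)
  refine ⟨0, n, 0, Q, ⟨fun u _ => Subsingleton.elim _ _, fun u _ => Subsingleton.elim _ _⟩, hQ,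
    φ, f 0, hφ, fun x hx => ?_⟩
  obtain ⟨h1, h2⟩ := hφΘ x hx
  have h3 : κ x = x.1 := rfl
  rw [h3] at h2
  rw [h1]
  simp only [_root_.zero_apply, add_zero]
  exact h2

end NormalForm

theorem mainTheorem5 (n : ℕ) (f : (Fin (n + 2) → ℝ) → ℝ) (hf : ContDiff ℝ ∞ f)
    (hcrit : fderiv ℝ f 0 = 0)
    (hker : secondDifferentialKer f = Submodule.span ℝ {stdVec 0, stdVec 1}) :
    (HasTypeD4 f ↔ discr3 f ≠ 0) ∧
    (discr3 f ≠ 0 →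
      ∃ (φ : OpenPartialHomeomorph (Fin (n + 2) → ℝ) (Fin (n + 2) → ℝ)) (d : ℝ)
        (Q : QuadraticForm ℝ (Fin n → ℝ)),
        IsChangeOfVariables φ ∧ Q.polarBilin.Nondegenerate ∧
        ∀ k ∈ φ.source,
          f k = d + φ k 0 ^ 2 * φ k 1 + discr3 f * φ k 1 ^ 3
            + Q (fun i : Fin n => φ k i.succ.succ)) ∧
    (HasTypeD4Plus f ↔ 0 < discr3 f) ∧
    (HasTypeD4Minus f ↔ discr3 f < 0) := by
  have hplus_eq : (fun x : Fin 2 → ℝ => x 0 ^ 2 * x 1 + x 1 ^ 3) =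
      fun x => x 0 ^ 2 * x 1 + 1 * x 1 ^ 3 := by ext; ring
  have hminus_eq : (fun x : Fin 2 → ℝ => x 0 ^ 2 * x 1 - x 1 ^ 3) =
      fun x => x 0 ^ 2 * x 1 + (-1) * x 1 ^ 3 := by ext; ring
  have hplus : HasTypeD4Plus f ↔ 0 < discr3 f := by
    unfold HasTypeD4Plus
    rw [hplus_eq]
    refine ⟨fun h => ?_, fun h => stablyRPlusEquivalent_of_discr3 hf hcrit hker (by linarith)⟩
    obtain ⟨δ, hδ, h⟩ := h.exists_discr3_eq hf hcrit hker
    rw [h]; positivity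
  have hminus : HasTypeD4Minus f ↔ discr3 f < 0 := by
    unfold HasTypeD4Minus
    rw [hminus_eq]
    refine ⟨fun h => ?_, fun h => stablyRPlusEquivalent_of_discr3 hf hcrit hker (by linarith)⟩
    obtain ⟨δ, hδ, h⟩ := h.exists_discr3_eq hf hcrit hker
    rw [h]
    have : 0 < δ ^ 6 := by positivity
    linarith
  refine ⟨?_, fun hne => ?_, hplus, hminus⟩
  · unfold HasTypeD4
    rw [hplus, hminus, or_comm]
    exact lt_or_lt_iff_ne
  · obtain ⟨Θ, Θ', Q, hΘ, hΘ0, hΘd, hQ, hfΘ⟩ :=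
      exists_normal_form hf hcrit hker (e := discr3 f) (mul_self_pos.2 hne)
    have hd : HasFDerivAt (fun k => consEquiv n (Θ k))
        ((Θ'.trans (consEquiv n) : _ ≃L[ℝ] _) : _ →L[ℝ] _) 0 :=
      (consEquiv n).hasFDerivAt.comp 0 hΘd
    obtain ⟨φ, hφ, hφΘ⟩ := ContDiff.exists_isChangeOfVariables
      ((consEquiv n).contDiff.comp hΘ) _ hd (by simp [hΘ0]) hfΘ
    refine ⟨φ, f 0, Q, hφ, hQ, fun k hk => ?_⟩
    obtain ⟨h1, h2⟩ := hφΘ k hk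
    rw [h2, h1]
    simp only [Function.comp_apply, consEquiv_apply_zero, consEquiv_apply_one,
      consEquiv_apply_succ]
    ring
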